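/- For a sheaf of sets $\mathcal F$ on the Nisnevich site $Sm/\mathbb C$ of smooth schemes of finite type over $\mathbb C$, let $\mathcal S(\mathcal F)$ be the Nisnevich sheafification of the presheaf $U\mapsto \mathcal F(U)/\!\sim$, where $\sim$ is the equivalence relation generated by $x_0\sim x_1$ whenever there is $h\in\mathcal F(\mathbb A^1\times U)$ with $h(0)=x_0$ and $h(1)=x_1$. Put $\mathcal S^0(\mathcal F)=\mathcal F$ and $\mathcal S^{m+1}(\mathcal F)=\mathcal S(\mathcal S^m(\mathcal F))$; there are canonical maps $\mathcal S^m(\mathcal F)\to\mathcal S^{m+1}(\mathcal F)$. A $\mathbb C$-scheme $X$ is regarded as the sheaf $U\mapsto \mathrm{Hom}_{\mathbb C}(U,X)$ on $Sm/\mathbb C$. A variety over $\mathbb C$ is an integral separated scheme of finite type over $\mathbb C$. Let $\lambda_1,\lambda_2,\lambda_3\in\mathbb C\setminus\{0\}$ be pairwise distinct, let $f(x)=(x-\lambda_1)(x-\lambda_2)(x-\lambda_3)$, and let $$X_1=\operatorname{Spec}\bigl(\mathbb C[x_0,x_1,y_1]/(y_1^2-x_0^2f(x_1))\bigr)\setminus\{(0,0,0)\},$$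 with $\phi_1,\psi_1:X_1\to\mathbb A^1_{\mathbb C}$ the projections to the $x_0$-axis and to the $x_1$-axis. Let $X_0=\mathbb A^1_{\mathbb C}$ and, for $n\ge 1$, let $$X_n=X_1\times_{\psi_1,\mathbb A^1_{\mathbb C},\phi_1}X_1\times_{\psi_1,\mathbb A^1_{\mathbb C},\phi_1}\cdots\times_{\psi_1,\mathbb A^1_{\mathbb C},\phi_1}X_1\qquad(n\text{ factors}).$$ Theorem. For every $n\in\mathbb N$ (including $n=0$), $X_n$ is a variety over $\mathbb C$ of dimension $n+1$, and $\mathcal S^n(X_n)(\mathbb C)\neq\mathcal S^{n+1}(X_n)(\mathbb C)$ in the sense that the canonical map $\mathcal S^n(X_n)(\mathbb C)\to\mathcal S^{n+1}(X_n)(\mathbb C)$ is not injective (in particular, $\mathcal S^n(X_n)\to\mathcal S^{n+1}(X_n)$ is not an isomorphism). -/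

import Mathlib

open CategoryTheory Limits AlgebraicGeometry Opposite

noncomputable section

namespace NaiveA1

/-! ### The Nisnevich site of smooth schemes over a field -/

/-- Smooth morphisms of finite type. (Smooth morphisms are locally of finite type.) -/
abbrev smoothFiniteType : MorphismProperty Scheme.{0} := @Smooth ⊓ @QuasiCompact

/-- `Sm k`: the category of smooth schemes of finite type over `Spec k` and all `k`-morphisms. -/
abbrev Sm (k : Type) [Field k] : Type 1 :=
  smoothFiniteType.Over ⊤ (Spec (.of k))

/-- The final object `Spec k` of `Sm k`. -/
def pt (k : Type) [Field k] : Sm k :=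
  MorphismProperty.Over.mk ⊤ (𝟙 (Spec (.of k))) ⟨inferInstance, inferInstance⟩

/-- If `v ∈ V` maps to `g w` with trivial residue field extension, there is a point of
`V ×[U] W` over `w`, again with trivial residue field extension. -/
lemma exists_lift_residue {U V W : Scheme.{0}} (f : V ⟶ U) (g : W ⟶ U) (v : V) (w : W)
    (h : f v = g w) (hb : Function.Bijective (f.residueFieldMap v)) :
    ∃ p : (pullback f g : Scheme.{0}), pullback.snd f g p = w ∧
      Function.Bijective ((pullback.snd f g).residueFieldMap p) := by
  have : IsIso (f.residueFieldMap v) := (ConcreteCategory.isIso_iff_bijective _).2 hb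
  let c : V.residueField v ⟶ W.residueField w :=
    inv (f.residueFieldMap v) ≫ (U.residueFieldCongr h).hom ≫ g.residueFieldMap w
  have hc : (Spec.map c ≫ V.fromSpecResidueField v) ≫ f = W.fromSpecResidueField w ≫ g := by
    rw [Category.assoc, ← Scheme.Hom.SpecMap_residueFieldMap_fromSpecResidueField,
      ← Spec.map_comp_assoc, ← Scheme.Hom.SpecMap_residueFieldMap_fromSpecResidueField]
    simp [c]
  let l : Spec (.of (W.residueField w)) ⟶ pullback f g := pullback.lift _ _ hc
  obtain ⟨⟨p, d⟩, hd⟩ :=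
    (Scheme.SpecToEquivOfField (W.residueField w) (pullback f g)).symm.surjective l
  change Spec.map d ≫ Scheme.fromSpecResidueField _ p = l at hd
  have hls : l ≫ pullback.snd f g = W.fromSpecResidueField w := pullback.lift_snd _ _ _
  have hp : pullback.snd f g p = w := by
    let t : ↥(Spec (CommRingCat.of (W.residueField w))) :=
      IsLocalRing.closedPoint (W.residueField w)
    have h1 : (l ≫ pullback.snd f g) t = W.fromSpecResidueField w t := by rw [hls]
    rw [← hd, Scheme.Hom.comp_apply, Scheme.Hom.comp_apply, Scheme.fromSpecResidueField_apply,
      Scheme.fromSpecResidueField_apply] at h1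
    exact h1
  have hrd : (pullback.snd f g).residueFieldMap p ≫ d = (W.residueFieldCongr hp).hom := by
    rw [← Spec.map_inj, ← cancel_mono (W.fromSpecResidueField _),
      Scheme.residueFieldCongr_fromSpecResidueField, Spec.map_comp, Category.assoc,
      Scheme.Hom.SpecMap_residueFieldMap_fromSpecResidueField, reassoc_of% hd]
    exact hls
  refine ⟨p, hp, RingHom.injective _, fun y => ?_⟩
  have hs : Function.Surjective ((pullback.snd f g).residueFieldMap p ≫ d) := by
    rw [hrd]
    exact ((ConcreteCategory.isIso_iff_bijective _).1 inferInstance).2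
  obtain ⟨z, hz⟩ := hs (d y)
  exact ⟨z, d.hom.injective hz⟩

/-- A sieve on `U` is a Nisnevich covering if every point `x` of `U` is the image, with trivial
residue field extension, of a point of some étale `V ⟶ U` belonging to the sieve. -/
def IsNisnevichCovering {k : Type} [Field k] {U : Sm k} (S : Sieve U) : Prop :=
  ∀ x : U.left, ∃ (V : Sm k) (f : V ⟶ U), S f ∧ Etale f.left ∧
    ∃ v : V.left, f.left v = x ∧ Function.Bijective (f.left.residueFieldMap v)

/-- The Nisnevich topology on `Sm k`. -/
def nisnevich (k : Type) [Field k] : GrothendieckTopology (Sm k) where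
  sieves U := {S | IsNisnevichCovering S}
  top_mem' U x := by
    refine ⟨U, 𝟙 U, trivial, ?_, x, rfl, ?_⟩
    · change Etale (𝟙 U.left)
      infer_instance
    · change Function.Bijective (Scheme.Hom.residueFieldMap (𝟙 U.left) x)
      rw [Scheme.residueFieldMap_id]
      exact Function.bijective_id
  pullback_stable' U W S g hS w := by
    obtain ⟨V, f, hf, he, v, hv, hb⟩ := hS (g.left w)
    obtain ⟨p, hp, hpb⟩ := exists_lift_residue f.left g.left v w hv hb
    have : Smooth W.hom := W.prop.1
    have : QuasiCompact W.hom := W.prop.2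
    have : Smooth U.hom := U.prop.1
    have : QuasiCompact (f.left ≫ U.hom) := by
      rw [MorphismProperty.Over.w]
      exact V.prop.2
    have : IsLocallyNoetherian U.left := LocallyOfFiniteType.isLocallyNoetherian (Y := Spec (.of k)) U.hom
    have : QuasiCompact f.left := QuasiCompact.of_comp (Z := Spec (.of k)) f.left U.hom
    let P : Sm k := MorphismProperty.Over.mk ⊤ (pullback.snd f.left g.left ≫ W.hom)
      ⟨inferInstance, inferInstance⟩
    let q : P ⟶ W := MorphismProperty.Over.homMk (pullback.snd f.left g.left) rfl trivial
    let r : P ⟶ V := MorphismProperty.Over.homMk (pullback.fst f.left g.left) (by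
      change _ = pullback.snd f.left g.left ≫ W.hom
      rw [← MorphismProperty.Over.w f, ← MorphismProperty.Over.w g]
      exact pullback.condition_assoc _)
      trivial
    refine ⟨P, q, ?_, (inferInstance : Etale (pullback.snd f.left g.left)), p, hp, hpb⟩
    have hqr : q ≫ g = r ≫ f := MorphismProperty.Over.Hom.ext pullback.condition.symm
    change S (q ≫ g)
    rw [hqr]
    exact S.downward_closed hf r
  transitive' U S hS R hR x := by
    obtain ⟨V, f, hf, he, v, rfl, hb⟩ := hS x
    obtain ⟨W, g, hg, he', w, rfl, hb'⟩ := hR hf v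
    refine ⟨W, g ≫ f, hg, ?_, w, rfl, ?_⟩
    · change Etale (g.left ≫ f.left)
      infer_instance
    · change Function.Bijective (Scheme.Hom.residueFieldMap (g.left ≫ f.left) w)
      rw [Scheme.residueFieldMap_comp]
      exact hb'.comp hb

/-! ### Naive `𝔸¹`-connected components -/

/-- The affine line over a scheme. -/
abbrev A1 (S : Scheme.{0}) : Scheme.{0} := 𝔸(PUnit.{1}; S)

/-- The coordinate projection of the affine line is smooth of finite type. -/
lemma smoothFiniteType_A1 (S : Scheme.{0}) : smoothFiniteType (A1 S ↘ S) := by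
  refine ⟨?_, inferInstance⟩
  have := isIso_of_isTerminal specULiftZIsTerminal.{0} terminalIsTerminal (terminal.from _)
  have : Smooth (terminal.from (Spec (.of (MvPolynomial PUnit.{1} (ULift.{0} ℤ))))) := by
    have : Smooth (Spec.map (CommRingCat.ofHom
        (MvPolynomial.C : ULift.{0} ℤ →+* MvPolynomial PUnit.{1} (ULift.{0} ℤ)))) := by
      rw [HasRingHomProperty.Spec_iff (P := @Smooth)]
      change RingHom.Smooth
        (algebraMap (ULift.{0} ℤ) (MvPolynomial PUnit.{1} (ULift.{0} ℤ)))
      rw [RingHom.smooth_algebraMap]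
      exact ⟨inferInstance, inferInstance⟩
    rw [← terminal.comp_from (Spec.map (CommRingCat.ofHom
      (MvPolynomial.C : ULift.{0} ℤ →+* MvPolynomial PUnit.{1} (ULift.{0} ℤ))))]
    infer_instance
  exact inferInstanceAs (Smooth (pullback.fst (terminal.from S)
    (terminal.from (Spec (.of (MvPolynomial PUnit.{1} (ULift.{0} ℤ)))))))

variable {k : Type} [Field k]

/-- The functor `U ↦ 𝔸¹ × U` on `Sm k`. -/
def cyl : Sm k ⥤ Sm k where
  obj U := MorphismProperty.Over.mk ⊤ ((A1 U.left ↘ U.left) ≫ U.hom) (by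
    have := smoothFiniteType_A1 U.left
    have : Smooth (A1 U.left ↘ U.left) := this.1
    have : Smooth U.hom := U.prop.1
    have : QuasiCompact U.hom := U.prop.2
    exact ⟨inferInstance, inferInstance⟩)
  map {U V} f := MorphismProperty.Over.homMk (AffineSpace.map _ f.left) (by
    change _ ≫ (A1 V.left ↘ V.left) ≫ V.hom = (A1 U.left ↘ U.left) ≫ U.hom
    rw [AffineSpace.map_over_assoc, MorphismProperty.Over.w]) trivial
  map_id U := MorphismProperty.Over.Hom.ext (AffineSpace.map_id U.left)
  map_comp f g := MorphismProperty.Over.Hom.ext (AffineSpace.map_comp f.left g.left)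

/-- The section `u ↦ (t, u)` of `𝔸¹ × U ⟶ U` determined by a global function `t` on `U`,
used only for the constants `t = 0` and `t = 1`. -/
def sect (U : Sm k) (t : Γ(U.left, ⊤)) : U ⟶ cyl.obj U :=
  MorphismProperty.Over.homMk (AffineSpace.homOfVector (𝟙 U.left) fun _ => t) (by
    change _ ≫ (A1 U.left ↘ U.left) ≫ U.hom = U.hom
    rw [AffineSpace.homOfVector_over_assoc]
    exact Category.id_comp _) trivial

lemma sect_naturality {U V : Sm k} (f : V ⟶ U) (t : Γ(U.left, ⊤)) :
    f ≫ sect U t = sect V (f.left.appTop t) ≫ cyl.map f := by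
  refine MorphismProperty.Over.Hom.ext ?_
  change f.left ≫ AffineSpace.homOfVector _ _ =
    AffineSpace.homOfVector _ _ ≫ AffineSpace.map _ f.left
  refine AffineSpace.hom_ext ?_ fun i => ?_
  · simp
  · rw [Scheme.Hom.comp_appTop, Scheme.Hom.comp_appTop, CommRingCat.comp_apply,
      CommRingCat.comp_apply, AffineSpace.homOfVector_appTop_coord,
      AffineSpace.map_appTop_coord, AffineSpace.homOfVector_appTop_coord]

/-- Presheaves on `Sm k`. -/
abbrev PSh (k : Type) [Field k] := (Sm k)ᵒᵖ ⥤ Type 1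

/-- `x` and `y` are joined by a single `𝔸¹`-homotopy `h`, i.e. `h(0) = x` and `h(1) = y`. -/
def A1Homotopic (F : PSh k) (U : Sm k) (x y : F.obj (op U)) : Prop :=
  ∃ h : F.obj (op (cyl.obj U)),
    F.map (sect U 0).op h = x ∧ F.map (sect U 1).op h = y

lemma A1Homotopic.map {F : PSh k} {U V : Sm k} (f : V ⟶ U) {x y : F.obj (op U)}
    (h : A1Homotopic F U x y) : A1Homotopic F V (F.map f.op x) (F.map f.op y) := by
  obtain ⟨h, rfl, rfl⟩ := h
  refine ⟨F.map (cyl.map f).op h, ?_, ?_⟩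
  · have := sect_naturality f 0
    rw [map_zero] at this
    rw [← Functor.map_comp_apply, ← Functor.map_comp_apply, ← op_comp, ← op_comp, this]
  · have := sect_naturality f 1
    rw [map_one] at this
    rw [← Functor.map_comp_apply, ← Functor.map_comp_apply, ← op_comp, ← op_comp, this]

/-- The presheaf `U ↦ F(U) / ∼`, where `∼` is the equivalence relation generated by
`𝔸¹`-homotopy. -/
def naivePre (F : PSh k) : PSh k where
  obj U := Quot (A1Homotopic F U.unop)
  map f := ↾ (Quot.map (F.map f) fun _ _ h => h.map f.unop)
  map_id _ := by
    ext ⟨x⟩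
    simp [Quot.map]
  map_comp f g := by
    ext ⟨x⟩
    simp [Quot.map]

/-- The quotient map. -/
def toNaivePre (F : PSh k) : F ⟶ naivePre F where
  app _ := ↾ (Quot.mk _)
  naturality _ _ _ := rfl

/-- `𝒮(F)`: the sheaf of naive `𝔸¹`-connected components. -/
def naive (F : PSh k) : PSh k := sheafify (nisnevich k) (naivePre F)

/-- The canonical map `F ⟶ 𝒮(F)`. -/
def toNaive (F : PSh k) : F ⟶ naive F := toNaivePre F ≫ toSheafify (nisnevich k) (naivePre F)

/-- The `n`-fold iterate `𝒮ⁿ(F)`. -/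
def naiveIter (F : PSh k) : ℕ → PSh k
  | 0 => F
  | n + 1 => naive (naiveIter F n)

/-- The canonical map `𝒮ⁿ(F) ⟶ 𝒮ⁿ⁺¹(F)`. -/
def naiveIterSucc (F : PSh k) (n : ℕ) : naiveIter F n ⟶ naiveIter F (n + 1) :=
  toNaive (naiveIter F n)

/-- The functor of points `U ↦ Hom_k(U, X)` on `Sm k` of an arbitrary `k`-scheme `X`
(with values in `Type 1`, where sheafification on `Sm k` takes place). -/
def points (X : Over (Spec (.of k))) : PSh k :=
  (MorphismProperty.Over.forget smoothFiniteType ⊤ (Spec (.of k))).op ⋙ yoneda.obj X ⋙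
    uliftFunctor.{1, 0}

/-! ### Varieties -/

/-- A variety over `k`: an integral separated scheme of finite type over `k`. -/
structure IsVariety (X : Over (Spec (.of k))) : Prop where
  isIntegral : IsIntegral X.left
  isSeparated : IsSeparated X.hom
  locallyOfFiniteType : LocallyOfFiniteType X.hom
  quasiCompact : QuasiCompact X.hom

/-! ### The surface `X₁` and its iterated fibre products -/

section Construction

open MvPolynomial

variable (a b c : ℂ)

/-- `ℂ[x₀, x₁, y₁] / (y₁² - x₀² (x₁ - a)(x₁ - b)(x₁ - c))`, the variables being `X 0, X 1, X 2`. -/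
abbrev R₁ : Type :=
  MvPolynomial (Fin 3) ℂ ⧸
    Ideal.span {(X 2 ^ 2 - X 0 ^ 2 * ((X 1 - C a) * (X 1 - C b) * (X 1 - C c)) :
      MvPolynomial (Fin 3) ℂ)}

/-- The class of the `i`-th variable in the coordinate ring. -/
def coord₁ (i : Fin 3) : R₁ a b c := Ideal.Quotient.mk _ (X i)

/-- The affine surface `Y₁ : y₁² = x₀² (x₁ - a)(x₁ - b)(x₁ - c)` in `𝔸³`. -/
abbrev Y₁ : Scheme.{0} := Spec (.of (R₁ a b c))

/-- The open complement in `Y₁` of the origin, i.e. of the common zero locus of the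
coordinates. -/
def awayOrigin : (Y₁ a b c).Opens where
  carrier := (PrimeSpectrum.zeroLocus (Set.range (coord₁ a b c)))ᶜ
  is_open' := (PrimeSpectrum.isClosed_zeroLocus _).isOpen_compl

/-- The surface `X₁ = Y₁ ∖ {(0,0,0)}`. -/
abbrev X₁ : Scheme.{0} := (awayOrigin a b c).toScheme

/-- The `i`-th coordinate as a map `X₁ ⟶ 𝔸¹` over `ℂ`. -/
def proj₁ (i : Fin 3) : X₁ a b c ⟶ A1 (Spec (.of ℂ)) :=
  (awayOrigin a b c).ι ≫
    AffineSpace.homOfVector (Spec.map (CommRingCat.ofHom (algebraMap ℂ (R₁ a b c))))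
      fun _ => (Scheme.ΓSpecIso (.of (R₁ a b c))).inv (coord₁ a b c i)

/-- `φ₁ : X₁ ⟶ 𝔸¹`, the projection to the `x₀`-axis. -/
abbrev φ₁ : X₁ a b c ⟶ A1 (Spec (.of ℂ)) := proj₁ a b c 0

/-- `ψ₁ : X₁ ⟶ 𝔸¹`, the projection to the `x₁`-axis. -/
abbrev ψ₁ : X₁ a b c ⟶ A1 (Spec (.of ℂ)) := proj₁ a b c 1

/-- The `n`-fold fibre product `X₁ ×_{ψ₁, 𝔸¹, φ₁} X₁ ×_{ψ₁, 𝔸¹, φ₁} ⋯ ×_{ψ₁, 𝔸¹, φ₁} X₁`,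
regarded as a scheme over `𝔸¹` through `φ₁` on the first factor; for `n = 0` it is `𝔸¹`. -/
def tower : ℕ → Over (A1 (Spec (.of ℂ)))
  | 0 => Over.mk (𝟙 _)
  | n + 1 => Over.mk (pullback.fst (ψ₁ a b c) (tower n).hom ≫ φ₁ a b c)

/-- The `n`-fold fibre product as a scheme over `ℂ`. -/
def Xn (n : ℕ) : Over (Spec (.of ℂ)) :=
  (Over.map (A1 (Spec (.of ℂ)) ↘ Spec (.of ℂ))).obj (tower a b c n)

end Construction

end NaiveA1

end

/-!
The proof rests on one fact: for every `n` the sheaf `Xₙ` is a retract of `𝒮(Xₙ₊₁)`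
(`nonempty_retract_naive`). Since `𝒮` is a functor (`naiveMap`), it preserves retracts, and by
induction `𝔸¹ = X₀` is a retract of `𝒮ⁿ(Xₙ)` (`nonempty_retract_naiveIter`). The points `0` and `1`
of `𝔸¹` are different but homotopic; their images in `𝒮ⁿ(Xₙ)(ℂ)` are different because of the
retraction, homotopic by functoriality, and so equal in `𝒮ⁿ⁺¹(Xₙ)(ℂ)` (`not_injective_toNaive`).

*The retraction.* The projection `Xₙ₊₁ ⟶ Xₙ` forgetting the first factor is constant along
`𝔸¹`-homotopies (`sec_comp_towerSnd`), hence factors through `𝒮(Xₙ₊₁)`, as `Xₙ` is a Nisnevich sheaf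
(`isSheaf_points`). As smooth schemes are reduced, this may be checked on `ℂ`-points, where it says
that a curve `𝔸¹ ⟶ Xₙ₊₁` has constant image in `Xₙ`. A curve `(x₀, x₁, y₁)` in `X₁` has constant
`x₁`: if `x₀ = 0`, then `x₁` has no zero; if `x₀ ≠ 0`, then `y₁ / x₀` is a polynomial square root of
`f(x₁)`, and as the three factors of `f(x₁)` are pairwise coprime, two of them are squares with
constant difference. Moving along the factors, all later coordinates are constant.

*The section.* A point of `Xₙ` with first coordinate `x` lifts to `Xₙ₊₁` by the choice of `x₀` and
`y` with `y² = x₀² f(x)`, not both `x₀` and `x` being zero. Where `x` is invertible, all lifts are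
homotopic to the lift with `x₀ = y = 0` through `(s x₀, x, s y)` (`exists_homotopy_zero`), so they
define a single section of `𝒮(Xₙ₊₁)`. Near `x = 0` one takes `x₀ = 1` and for `y` the square root of
`f(x)` with value `t₀` at `x = 0`, where `t₀² = f(0) ≠ 0`; it exists on a Nisnevich neighbourhood
(`exists_etale_sqrt`). The local lifts therefore glue to a map `Xₙ ⟶ 𝒮(Xₙ₊₁)`
(`exists_hom_of_locally`, `IsGoodLift`).

*Geometry of `Xₙ`.* By induction `Xₙ` is an open subscheme of `Spec D` for a domain `D` in which `f`
of the first coordinate is not a square; then `Xₙ₊₁` is open in the spectrum of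
`D[X][Y] / (Y² - X² f(x))` (`TowerModel`), which is finite and free over `D[X]`. This gives
integrality, and the dimension is found from `dim D[X] = dim D + 1` together with a closed point of
`Xₙ` of full height.
-/

noncomputable section

namespace NaiveA1

section

variable {k : Type} [Field k]

/-! ### Schemes are Nisnevich sheaves -/

/-- Étale descent for morphisms of schemes: a representable functor is an fppf sheaf. -/
lemma isSheafFor_yoneda_of_etale {ι : Type} {U Z : Scheme.{0}} {V : ι → Scheme.{0}}
    (f : ∀ i, V i ⟶ U) [∀ i, Etale (f i)] (hf : ∀ x, ∃ i, x ∈ Set.range (f i)) :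
    Presieve.IsSheafFor (yoneda.obj Z) (Presieve.ofArrows V f) := by
  rw [Presieve.isSheafFor_iff_generate]
  refine GrothendieckTopology.Subcanonical.isSheaf_of_isRepresentable (J := Scheme.fppfTopology)
    (yoneda.obj Z) _ (Precoverage.generate_mem_toGrothendieck (R := Presieve.ofArrows V f) ?_)
  exact (Scheme.ofArrows_mem_precoverage_iff _).2 ⟨hf, fun i => ⟨inferInstance, inferInstance⟩⟩

/-- The base change of an étale morphism of `Sm k` along a morphism of `Sm k`. -/
lemma exists_pullback {U V W : Sm k} (f : V ⟶ U) (g : W ⟶ U) [Etale f.left] :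
    ∃ (P : Sm k) (q : P ⟶ W) (r : P ⟶ V), IsPullback r.left q.left f.left g.left := by
  have : Smooth W.hom := W.prop.1
  have : QuasiCompact W.hom := W.prop.2
  have : Smooth U.hom := U.prop.1
  have : QuasiCompact (f.left ≫ U.hom) := by
    rw [MorphismProperty.Over.w]
    exact V.prop.2
  have : IsLocallyNoetherian U.left := LocallyOfFiniteType.isLocallyNoetherian (Y := Spec (.of k)) U.hom
  have : QuasiCompact f.left := QuasiCompact.of_comp (Z := Spec (.of k)) f.left U.hom
  let P : Sm k := MorphismProperty.Over.mk ⊤ (pullback.snd f.left g.left ≫ W.hom)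
    ⟨inferInstance, inferInstance⟩
  let q : P ⟶ W := MorphismProperty.Over.homMk (pullback.snd f.left g.left) rfl trivial
  let r : P ⟶ V := MorphismProperty.Over.homMk (pullback.fst f.left g.left) (by
    change _ = pullback.snd f.left g.left ≫ W.hom
    rw [← MorphismProperty.Over.w f, ← MorphismProperty.Over.w g]
    exact pullback.condition_assoc _) trivial
  exact ⟨P, q, r, IsPullback.of_hasPullback _ _⟩

/-- Morphisms of schemes out of `U` may be compared on a Nisnevich covering of `U`. -/
lemma IsNisnevichCovering.hom_ext {U : Sm k} {S : Sieve U} (hS : IsNisnevichCovering S)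
    {Z : Scheme.{0}} {a b : U.left ⟶ Z}
    (h : ∀ ⦃V : Sm k⦄ (f : V ⟶ U), S f → f.left ≫ a = f.left ≫ b) : a = b := by
  choose V f hf he v hv _ using hS
  refine (isSheafFor_yoneda_of_etale (Z := Z) (fun x => (f x).left)
    fun x => ⟨x, v x, hv x⟩).isSeparatedFor.ext ?_
  rintro _ _ ⟨x⟩
  exact h _ (hf x)

/-- A scheme over `k` is a sheaf on the Nisnevich site of `k`. -/
lemma isSheaf_points (X : Over (Spec (.of k))) : Presheaf.IsSheaf (nisnevich k) (points X) := by
  rw [isSheaf_iff_isSheaf_of_type]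
  intro U S hS s hs
  have hS' : IsNisnevichCovering S := hS
  have hs' := (Presieve.compatible_iff_sieveCompatible _).1 hs
  choose V₀ f hf he v hv hb using hS'
  let T {V : Sm k} (f : V ⟶ U) (hf : S f) : V.left ⟶ X.left := (s f hf).down.left
  have hT {V W : Sm k} (g : W ⟶ V) (f : V ⟶ U) (hf : S f) :
      T (g ≫ f) (S.downward_closed hf g) = g.left ≫ T f hf := by
    have := hs' f g hf
    exact congr(($this).down.left)
  -- Glue along the étale covering of `U` by the neighbourhoods `f x`, one for each point `x`.
  obtain ⟨a, ha, -⟩ := (Presieve.isSheafFor_arrows_iff _ _).1 (isSheafFor_yoneda_of_etale (Z := X.left)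
    (fun x => (f x).left) fun x => ⟨x, v x, hv x⟩) (fun x => T (f x) (hf x)) (by
      intro x y Z gx gy hg
      obtain ⟨P, q, r, hP⟩ := exists_pullback (f x) (f y)
      have hqr : q ≫ f y = r ≫ f x := MorphismProperty.Over.Hom.ext hP.w.symm
      have h1 := hT q (f y) (hf y)
      have h2 := hT r (f x) (hf x)
      have h3 : r.left ≫ T (f x) (hf x) = q.left ≫ T (f y) (hf y) := by
        rw [← h1, ← h2]
        congr 1
        exact hqr.symm
      change gx ≫ _ = gy ≫ _
      rw [← hP.lift_fst gx gy hg, Category.assoc, h3, ← Category.assoc, hP.lift_snd])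
  -- On any other member of the sieve, compare on the base change of this covering.
  have ha' (V : Sm k) (g : V ⟶ U) (hg : S g) : g.left ≫ a = T g hg := by
    refine IsNisnevichCovering.hom_ext (S := Sieve.pullback g (Sieve.ofArrows _ f)) ?_ ?_
    · refine (nisnevich k).pullback_stable g (S := Sieve.ofArrows _ f) ?_
      intro x
      exact ⟨V₀ x, f x, Sieve.ofArrows_mk _ _ _, he x, v x, hv x, hb x⟩
    · intro W h hh
      obtain ⟨_, r, _, ⟨x⟩, hx⟩ := hh
      have h1 : r.left ≫ (f x).left = h.left ≫ g.left := congr(($hx).left)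
      have := ha x
      change (f x).left ≫ a = _ at this
      rw [← hT, ← Category.assoc, ← h1, Category.assoc, this, ← hT]
      congr 1
  have haX : a ≫ X.hom = U.hom := by
    refine IsNisnevichCovering.hom_ext hS ?_
    intro V g hg
    rw [← Category.assoc, ha' V g hg, MorphismProperty.Over.w g]
    exact Over.w (s g hg).down
  refine ⟨⟨Over.homMk a haX⟩, ?_, ?_⟩
  · intro V g hg
    refine ULift.ext _ _ (Over.OverMorphism.ext ?_)
    exact ha' V g hg
  · intro b hb
    refine ULift.ext _ _ (Over.OverMorphism.ext ?_)
    refine IsNisnevichCovering.hom_ext hS ?_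
    intro V g hg
    have h1 := hb g hg
    exact (congr(($h1).down.left)).trans (ha' V g hg).symm

/-! ### Functoriality of `𝒮` and retracts -/

/-- The map `F / ∼ ⟶ G` induced by a map `F ⟶ G` that is constant along homotopies. -/
def naivePreDesc {F G : PSh k} (p : F ⟶ G)
    (hp : ∀ U (h : F.obj (op (cyl.obj U))),
      p.app (op U) (F.map (sect U 0).op h) = p.app (op U) (F.map (sect U 1).op h)) :
    naivePre F ⟶ G where
  app U := ↾ (Quot.lift (p.app U) (by
    rintro _ _ ⟨h, rfl, rfl⟩
    exact hp U.unop h))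
  naturality U V f := by
    ext ⟨x⟩
    exact NatTrans.naturality_apply p f x

/-- The map `𝒮(F) ⟶ G` to a sheaf induced by a map `F ⟶ G` that is constant along homotopies. -/
def naiveDesc {F G : PSh k} (hG : Presheaf.IsSheaf (nisnevich k) G) (p : F ⟶ G)
    (hp : ∀ U (h : F.obj (op (cyl.obj U))),
      p.app (op U) (F.map (sect U 0).op h) = p.app (op U) (F.map (sect U 1).op h)) :
    naive F ⟶ G :=
  sheafifyLift (nisnevich k) (naivePreDesc p hp) hG

lemma toNaive_naiveDesc {F G : PSh k} (hG : Presheaf.IsSheaf (nisnevich k) G) (p : F ⟶ G) (hp) :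
    toNaive F ≫ naiveDesc hG p hp = p :=
  (Category.assoc _ _ _).trans
    (congrArg (toNaivePre F ≫ ·) (toSheafify_sheafifyLift (nisnevich k) (naivePreDesc p hp) hG))

lemma isSheaf_naive (F : PSh k) : Presheaf.IsSheaf (nisnevich k) (naive F) :=
  ((presheafToSheaf (nisnevich k) _).obj _).property

lemma naive_hom_ext {F G : PSh k} (hG : Presheaf.IsSheaf (nisnevich k) G) {p q : naive F ⟶ G}
    (h : toNaive F ≫ p = toNaive F ≫ q) : p = q := by
  refine sheafify_hom_ext _ _ _ hG ?_
  ext U ⟨x⟩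
  exact congr($(h).app U x)

lemma toNaive_app_eq {F : PSh k} {U : Sm k} {x y : F.obj (op U)} (h : A1Homotopic F U x y) :
    (toNaive F).app (op U) x = (toNaive F).app (op U) y :=
  congr((toSheafify (nisnevich k) (naivePre F)).app (op U) $(Quot.sound h))

/-- `𝒮` is functorial. -/
def naiveMap {F G : PSh k} (p : F ⟶ G) : naive F ⟶ naive G :=
  naiveDesc (isSheaf_naive G) (p ≫ toNaive G) (by
    intro U h
    refine toNaive_app_eq ⟨p.app _ h, ?_, ?_⟩
    · exact (NatTrans.naturality_apply p _ _).symm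
    · exact (NatTrans.naturality_apply p _ _).symm)

lemma toNaive_naiveMap {F G : PSh k} (p : F ⟶ G) : toNaive F ≫ naiveMap p = p ≫ toNaive G :=
  toNaive_naiveDesc _ _ _

lemma naiveMap_comp {F G H : PSh k} (p : F ⟶ G) (q : G ⟶ H) :
    naiveMap p ≫ naiveMap q = naiveMap (p ≫ q) :=
  naive_hom_ext (isSheaf_naive _) (by
    refine (Category.assoc _ _ _).symm.trans ?_
    rw [toNaive_naiveMap]
    refine (Category.assoc _ _ _).trans ?_
    rw [toNaive_naiveMap, toNaive_naiveMap, Category.assoc])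

lemma naiveMap_id (F : PSh k) : naiveMap (𝟙 F) = 𝟙 (naive F) :=
  naive_hom_ext (isSheaf_naive _) ((toNaive_naiveDesc _ _ _).trans
    ((Category.id_comp _).trans (Category.comp_id _).symm))

/-- `𝒮ⁿ` preserves retracts. -/
def naiveIterRetract {F G : PSh k} (r : Retract F G) :
    ∀ n, Retract (naiveIter F n) (naiveIter G n)
  | 0 => r
  | n + 1 =>
    { i := naiveMap (naiveIterRetract r n).i
      r := naiveMap (naiveIterRetract r n).r
      retract := (naiveMap_comp _ _).trans
        ((congrArg naiveMap (naiveIterRetract r n).retract).trans (naiveMap_id _)) }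

lemma naiveIter_naive (F : PSh k) (n : ℕ) : naiveIter (naive F) n = naiveIter F (n + 1) := by
  induction n with
  | zero => rfl
  | succ n ih => exact congrArg naive ih

/-- If `𝒮(F (n + 1))` retracts onto `F n` for all `n`, then `𝒮ⁿ(F n)` retracts onto `F 0`. -/
lemma nonempty_retract_naiveIter {F : ℕ → PSh k} (h : ∀ n, Nonempty (Retract (F n) (naive (F (n + 1)))))
    (n : ℕ) : Nonempty (Retract (F 0) (naiveIter (F n) n)) := by
  induction n with
  | zero => exact ⟨.refl _⟩
  | succ n ih =>
    obtain ⟨r⟩ := ih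
    obtain ⟨s⟩ := h n
    rw [← naiveIter_naive]
    exact ⟨r.trans (naiveIterRetract s n)⟩

/-- If a presheaf retracts onto one with two different but homotopic sections, then its map to `𝒮`
is not injective on sections. -/
lemma not_injective_toNaive {F G : PSh k} (r : Retract F G) {U : Sm k} {x y : F.obj (op U)}
    (hxy : x ≠ y) (h : A1Homotopic F U x y) :
    ¬ Function.Injective ((toNaive G).app (op U)) := by
  intro hinj
  have hri (z : F.obj (op U)) : r.r.app _ (r.i.app _ z) = z := congr($(r.retract).app (op U) z)
  refine hxy ?_
  rw [← hri x, ← hri y]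
  congr 1
  refine hinj (toNaive_app_eq ?_)
  obtain ⟨h, rfl, rfl⟩ := h
  exact ⟨r.i.app _ h, (NatTrans.naturality_apply r.i _ _).symm,
    (NatTrans.naturality_apply r.i _ _).symm⟩

/-- A map to a sheaf defined by local sections: a relation `R` between sections of `F` and of `G`,
stable under restriction, functional, and satisfiable locally, comes from a map `F ⟶ G`. -/
lemma exists_hom_of_locally {F G : PSh k} (hG : Presheaf.IsSheaf (nisnevich k) G)
    (R : ∀ U : Sm k, F.obj (op U) → G.obj (op U) → Prop)
    (hR : ∀ {U V : Sm k} (f : V ⟶ U) {x y}, R U x y → R V (F.map f.op x) (G.map f.op y))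
    (huniq : ∀ {U : Sm k} {x y y'}, R U x y → R U x y' → y = y')
    (hex : ∀ {U : Sm k} (x : F.obj (op U)), ∃ S : Sieve U, IsNisnevichCovering S ∧
      ∀ ⦃V : Sm k⦄ (f : V ⟶ U), S f → ∃ y, R V (F.map f.op x) y) :
    ∃ s : F ⟶ G, ∀ {U : Sm k} {x y}, R U x y → s.app (op U) x = y := by
  rw [isSheaf_iff_isSheaf_of_type] at hG
  -- The glued section `y` of `G` is characterized by its restrictions, hence natural in `U`.
  have key : ∀ (U : Sm k) (x : F.obj (op U)), ∃ y : G.obj (op U), ∀ ⦃V : Sm k⦄ (f : V ⟶ U) (z),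
      R V (F.map f.op x) z → G.map f.op y = z := by
    intro U x
    obtain ⟨S, hS, h⟩ := hex x
    choose y hy using h
    have hy' : Presieve.FamilyOfElements.Compatible (P := G) (R := S.arrows) y := by
      refine (Presieve.compatible_iff_sieveCompatible (P := G) (S := S) (x := y)).2 ?_
      intro V W f g hf
      refine huniq (hy _ _) ?_
      have := hR g (hy f hf)
      rwa [← Functor.map_comp_apply, ← op_comp] at this
    obtain ⟨t, ht, -⟩ := hG S hS y hy'
    refine ⟨t, fun V f z hz => ?_⟩
    refine (hG _ ((nisnevich k).pullback_stable f hS)).isSeparatedFor.ext ?_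
    intro W g hg
    rw [← Functor.map_comp_apply, ← op_comp, ht (g ≫ f) hg]
    refine huniq (hy _ _) ?_
    have := hR g hz
    rwa [← Functor.map_comp_apply, ← op_comp] at this
  choose s hs using key
  refine ⟨{ app := fun U => ↾ (s U.unop), naturality := ?_ }, ?_⟩
  · intro U V f
    ext x
    obtain ⟨S, hS, h⟩ := hex (F.map f x)
    refine (hG S hS).isSeparatedFor.ext ?_
    intro W g hg
    obtain ⟨y, hy⟩ := h g hg
    refine (hs _ _ _ _ hy).trans ?_
    change _ = G.map g.op (G.map f (s _ x))
    rw [← Functor.map_comp_apply]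
    refine (hs _ _ (g ≫ f.unop) _ ?_).symm
    rw [← Functor.map_comp_apply] at hy
    exact hy
  · intro U x y hxy
    have := hs U x (𝟙 U) y (by simpa using hxy)
    simpa using this

end

/-! ### Smooth schemes over a field are reduced -/

/-- An étale algebra over a domain is flat, hence contained in its base change to the fraction
field, which is reduced. -/
lemma isReduced_of_etale_of_isDomain (R A : Type*) [CommRing R] [IsDomain R] [CommRing A]
    [Algebra R A] [Algebra.Etale R A] : IsReduced A := by
  have : IsReduced (TensorProduct R (FractionRing R) A) :=
    Algebra.FormallyUnramified.isReduced_of_field (FractionRing R) _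
  refine isReduced_of_injective
    (Algebra.TensorProduct.includeRight : A →ₐ[R] TensorProduct R (FractionRing R) A) ?_
  exact Algebra.TensorProduct.includeRight_injective (IsFractionRing.injective R _)

/-- Locally, a smooth scheme over a field is étale over an affine space, which is integral. -/
lemma isReduced_of_smooth {k : Type} [Field k] {X : Scheme.{0}} (f : X ⟶ Spec (.of k)) [Smooth f] :
    IsReduced X := by
  have (x : X) : _root_.IsReduced (X.presheaf.stalk x) := by
    obtain ⟨U, hU, V, hV, hx, e, h⟩ := Smooth.exists_isStandardSmooth f x
    have : Nonempty U := ⟨f x, e hx⟩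
    obtain ⟨n, g, hg, hg'⟩ := h.exists_etale_mvPolynomial
    algebraize [g]
    have this' : _root_.IsReduced Γ(X, V) := isReduced_of_etale_of_isDomain
      (MvPolynomial (Fin n) Γ(Spec (.of k), U)) _
    let y : V := ⟨x, hx⟩
    let := TopCat.Presheaf.algebra_section_stalk X.presheaf y
    have := hV.isLocalization_stalk y
    exact isReduced_localizationPreserves (hV.primeIdealOf y).asIdeal.primeCompl
      (X.presheaf.stalk (y : X)) this'
  exact isReduced_of_isReduced_stalk X

/-! ### Polynomial curves on `y² = x₀² f(x₁)` -/

open Polynomial in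
/-- If `f(x)` is a square, so are its pairwise coprime factors, up to units. From `x - a = r²` and
`x - b = s²` one gets `(r - s)(r + s) = b - a`, so that `r` and `s` are constant. -/
lemma exists_eq_C_of_sq_eq {a b c : ℂ} (hab : a ≠ b) (hac : a ≠ c) (hbc : b ≠ c) {t x : ℂ[X]}
    (h : t ^ 2 = (x - C a) * (x - C b) * (x - C c)) : ∃ d, x = C d := by
  have hcop : ∀ {d e : ℂ}, d ≠ e → IsCoprime (x - C d) (x - C e) := by
    intro d e hde
    refine ⟨C (e - d)⁻¹, -C (e - d)⁻¹, ?_⟩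
    have : C (e - d)⁻¹ * (C e - C d) = (1 : ℂ[X]) := by
      rw [← C_sub, ← C_mul, inv_mul_cancel₀ (sub_ne_zero.2 hde.symm), C_1]
    linear_combination this
  have hsq : ∀ {u v w : ℂ[X]}, IsCoprime u v → u * v = w ^ 2 → ∃ r, u = r ^ 2 := by
    intro u v w huv hw
    obtain ⟨r, hr⟩ := exists_associated_pow_of_mul_eq_pow' huv hw
    obtain ⟨e, he⟩ := hr
    obtain ⟨e', he', hee⟩ := Polynomial.isUnit_iff.1 e.isUnit
    obtain ⟨z, hz⟩ := IsAlgClosed.exists_pow_nat_eq e' (n := 2) two_pos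
    exact ⟨r * C z, by rw [← he, ← hee, mul_pow, ← C_pow, hz]⟩
  obtain ⟨r, hr⟩ := hsq ((hcop hab).mul_right (hcop hac)) (w := t) (by rw [h]; ring)
  obtain ⟨s, hs⟩ := hsq ((hcop hab.symm).mul_right (hcop hbc)) (w := t) (by rw [h]; ring)
  have hrs : (r - s) * (r + s) = C (b - a) := by
    rw [C_sub]
    linear_combination hs - hr
  have hu : IsUnit ((r - s) * (r + s)) := by
    rw [hrs]
    exact isUnit_C.2 (sub_ne_zero.2 hab.symm).isUnit
  obtain ⟨d, -, hd⟩ := Polynomial.isUnit_iff.1 (isUnit_of_mul_isUnit_left hu)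
  obtain ⟨e, -, he⟩ := Polynomial.isUnit_iff.1 (isUnit_of_mul_isUnit_right hu)
  refine ⟨((d + e) / 2) ^ 2 + a, ?_⟩
  have h2 : r = C ((d + e) / 2) := by
    have : C (2 : ℂ) * C ((d + e) / 2) = C d + C e := by
      rw [← C_mul, ← C_add]; congr 1; ring
    have h3 : (C (2 : ℂ)) ≠ 0 := by simp
    refine mul_left_cancel₀ h3 ?_
    rw [this, hd, he, C_ofNat]
    ring
  rw [C_add, C_pow, ← h2, ← hr]
  ring

open Polynomial in
/-- A polynomial curve on `y² = x₀² f(x₁)` avoiding the origin has constant `x₁`: either `y / x₀` is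
a polynomial, or `x₀ = 0` and then `x₁` has no zero. -/
lemma exists_eq_C_of_curve {a b c : ℂ} (hab : a ≠ b) (hac : a ≠ c) (hbc : b ≠ c)
    {x₀ x₁ y : ℂ[X]} (h : y ^ 2 = x₀ ^ 2 * ((x₁ - C a) * (x₁ - C b) * (x₁ - C c)))
    (h0 : ∀ s, ¬ (x₀.eval s = 0 ∧ x₁.eval s = 0)) : ∃ d, x₁ = C d := by
  rcases eq_or_ne x₀ 0 with rfl | hx
  · have : x₁.degree = 0 := by
      by_contra hd
      obtain ⟨s, hs⟩ := IsAlgClosed.exists_root x₁ hd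
      exact h0 s ⟨by simp, hs⟩
    exact ⟨_, eq_C_of_degree_eq_zero this⟩
  · obtain ⟨t, rfl⟩ : x₀ ∣ y := (IsIntegrallyClosed.pow_dvd_pow_iff two_ne_zero).1 ⟨_, h⟩
    refine exists_eq_C_of_sq_eq hab hac hbc (t := t) ?_
    refine mul_left_cancel₀ (pow_ne_zero 2 hx) ?_
    rw [← h]
    ring

/-! ### Morphisms to `𝔸¹` and to `X₁` in coordinates -/

/-- The ring homomorphism `R ⟶ Γ(T)` corresponding to a morphism `T ⟶ Spec R`. -/
def pull {R : CommRingCat.{0}} {T : Scheme.{0}} (f : T ⟶ Spec R) : R →+* Γ(T, ⊤) :=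
  ((Scheme.ΓSpecIso R).inv ≫ f.appTop).hom

/-- The morphism `T ⟶ Spec R` corresponding to a ring homomorphism `R ⟶ Γ(T)`. -/
def toSpec {R : CommRingCat.{0}} {T : Scheme.{0}} (φ : R →+* Γ(T, ⊤)) : T ⟶ Spec R :=
  T.toSpecΓ ≫ Spec.map (CommRingCat.ofHom φ)

lemma pull_toSpec {R : CommRingCat.{0}} {T : Scheme.{0}} (φ : R →+* Γ(T, ⊤)) :
    pull (toSpec φ) = φ := by
  simp [pull, toSpec, Scheme.toSpecΓ_appTop]

lemma pull_injective {R : CommRingCat.{0}} {T : Scheme.{0}} {f g : T ⟶ Spec R}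
    (h : pull f = pull g) : f = g := by
  refine ext_of_isAffine ?_
  rw [← cancel_epi (Scheme.ΓSpecIso R).inv]
  exact CommRingCat.hom_ext h

lemma pull_comp {R : CommRingCat.{0}} {S T : Scheme.{0}} (g : S ⟶ T) (f : T ⟶ Spec R) (r : R) :
    pull (g ≫ f) r = g.appTop (pull f r) := by
  rw [pull, Scheme.Hom.comp_appTop]
  rfl

lemma pull_comp_SpecMap {R R' : CommRingCat.{0}} {T : Scheme.{0}} (f : T ⟶ Spec R) (φ : R' ⟶ R)
    (r : R') : pull (f ≫ Spec.map φ) r = pull f (φ r) := by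
  have : (Scheme.ΓSpecIso R').inv ≫ (Spec.map φ).appTop = φ ≫ (Scheme.ΓSpecIso R).inv :=
    (Scheme.ΓSpecIso_inv_naturality φ).symm
  exact congr(f.appTop ($this r))

lemma mem_basicOpen_pull {R : CommRingCat.{0}} {T : Scheme.{0}} (f : T ⟶ Spec R) (r : R) (t : T) :
    t ∈ T.basicOpen (pull f r) ↔ r ∉ (f t).asIdeal := by
  have h1 : T.basicOpen (pull f r) = f ⁻¹ᵁ ((Spec R).basicOpen ((Scheme.ΓSpecIso R).inv r)) :=
    (Scheme.preimage_basicOpen_top f _).symm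
  rw [h1, basicOpen_eq_of_affine']
  simp
  rfl

/-- The coordinate function of a morphism to `𝔸¹`. -/
def crd {T S : Scheme.{0}} (g : T ⟶ A1 S) : Γ(T, ⊤) :=
  g.appTop (AffineSpace.coord S PUnit.unit)

lemma crd_comp {T T' S : Scheme.{0}} (f : T' ⟶ T) (g : T ⟶ A1 S) : crd (f ≫ g) = f.appTop (crd g) := by
  rw [crd, Scheme.Hom.comp_appTop]
  rfl

lemma crd_homOfVector {T S : Scheme.{0}} (q : T ⟶ S) (v : Γ(T, ⊤)) :
    crd (AffineSpace.homOfVector q fun _ => v) = v :=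
  AffineSpace.homOfVector_appTop_coord _ _ _

lemma A1_hom_ext {T S : Scheme.{0}} {f g : T ⟶ A1 S} (h : f ≫ (A1 S ↘ S) = g ≫ (A1 S ↘ S))
    (h' : crd f = crd g) : f = g :=
  AffineSpace.hom_ext h fun _ => h'

section

variable {a b c : ℂ} {T : Scheme.{0}}

/-- The structure morphism of `X₁`. -/
def X₁str (a b c : ℂ) : X₁ a b c ⟶ Spec (.of ℂ) :=
  (awayOrigin a b c).ι ≫ Spec.map (CommRingCat.ofHom (algebraMap ℂ (R₁ a b c)))

/-- The coordinate functions of a morphism to `X₁`. -/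
def crd₁ (f : T ⟶ X₁ a b c) (i : Fin 3) : Γ(T, ⊤) :=
  pull (f ≫ (awayOrigin a b c).ι) (coord₁ a b c i)

lemma proj₁_over (i : Fin 3) : proj₁ a b c i ≫ (A1 (Spec (.of ℂ)) ↘ Spec (.of ℂ)) = X₁str a b c := by
  simp [proj₁, X₁str]

lemma crd_proj₁ (f : T ⟶ X₁ a b c) (i : Fin 3) : crd (f ≫ proj₁ a b c i) = crd₁ f i := by
  rw [proj₁, ← Category.assoc, crd_comp, crd_homOfVector, crd₁]
  simp [pull]

lemma crd₁_comp {T' : Scheme.{0}} (g : T' ⟶ T) (f : T ⟶ X₁ a b c) (i : Fin 3) :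
    crd₁ (g ≫ f) i = g.appTop (crd₁ f i) := by
  rw [← crd_proj₁, Category.assoc, crd_comp, crd_proj₁]

lemma coord₁_eq : coord₁ a b c 2 ^ 2 = coord₁ a b c 0 ^ 2 *
    ((coord₁ a b c 1 - algebraMap ℂ _ a) * (coord₁ a b c 1 - algebraMap ℂ _ b) *
      (coord₁ a b c 1 - algebraMap ℂ _ c)) := by
  refine sub_eq_zero.1 (Ideal.Quotient.eq_zero_iff_mem.2 (Ideal.mem_span_singleton_self _))

lemma X₁_ext {f g : T ⟶ X₁ a b c} (h : f ≫ X₁str a b c = g ≫ X₁str a b c)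
    (h' : ∀ i, crd₁ f i = crd₁ g i) : f = g := by
  rw [← cancel_mono (awayOrigin a b c).ι]
  refine pull_injective (Ideal.Quotient.ringHom_ext (MvPolynomial.ringHom_ext ?_ h'))
  intro z
  have := congr(pull $h z)
  rw [X₁str, ← Category.assoc, ← Category.assoc] at this
  rwa [pull_comp_SpecMap, pull_comp_SpecMap] at this

lemma crd₁_eq (f : T ⟶ X₁ a b c) : crd₁ f 2 ^ 2 = crd₁ f 0 ^ 2 *
    ((crd₁ f 1 - pull (f ≫ X₁str a b c) a) * (crd₁ f 1 - pull (f ≫ X₁str a b c) b) *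
      (crd₁ f 1 - pull (f ≫ X₁str a b c) c)) := by
  have h (z : ℂ) : pull (f ≫ X₁str a b c) z =
      pull (f ≫ (awayOrigin a b c).ι) (algebraMap ℂ (R₁ a b c) z) := by
    rw [X₁str, ← Category.assoc]
    exact pull_comp_SpecMap _ _ _
  rw [h, h, h]
  simp only [crd₁]
  rw [← map_pow, coord₁_eq]
  simp only [map_mul, map_pow, map_sub]

lemma crd₁_ne (f : T ⟶ X₁ a b c) (t : T) :
    t ∈ T.basicOpen (crd₁ f 0) ∨ t ∈ T.basicOpen (crd₁ f 1) := by
  have h : (f ≫ (awayOrigin a b c).ι) t ∈ awayOrigin a b c := by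
    rw [Scheme.Hom.comp_apply]
    exact (f t).2
  have h' : (f ≫ (awayOrigin a b c).ι) t ∉ PrimeSpectrum.zeroLocus (Set.range (coord₁ a b c)) := h
  by_contra! hc
  rw [crd₁, crd₁, mem_basicOpen_pull, mem_basicOpen_pull, not_not, not_not] at hc
  refine h' ?_
  rintro _ ⟨i, rfl⟩
  fin_cases i
  · exact hc.1
  · exact hc.2
  · refine ((f ≫ (awayOrigin a b c).ι) t).isPrime.mem_of_pow_mem 2 ?_
    change coord₁ a b c 2 ^ 2 ∈ _
    rw [coord₁_eq]
    exact Ideal.mul_mem_right _ _ (Ideal.pow_mem_of_mem _ hc.1 2 two_pos)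

/-- Functions satisfying the equation of `X₁` such that the first two have no common zero define a
morphism to `X₁`: the third one vanishes wherever the first one does. -/
lemma exists_toX₁ (q : T ⟶ Spec (.of ℂ)) (v : Fin 3 → Γ(T, ⊤))
    (h : v 2 ^ 2 = v 0 ^ 2 * ((v 1 - pull q a) * (v 1 - pull q b) * (v 1 - pull q c)))
    (hne : ∀ t : T, t ∈ T.basicOpen (v 0) ∨ t ∈ T.basicOpen (v 1)) :
    ∃ f : T ⟶ X₁ a b c, f ≫ X₁str a b c = q ∧ ∀ i, crd₁ f i = v i := by
  let φ : R₁ a b c →+* Γ(T, ⊤) := Ideal.Quotient.lift _ (MvPolynomial.eval₂Hom (pull q) v) (by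
    intro p hp
    obtain ⟨r, rfl⟩ := Ideal.mem_span_singleton'.1 hp
    rw [map_mul]
    refine mul_eq_zero_of_right _ ?_
    simp [h])
  have hφ (i) : φ (coord₁ a b c i) = v i := by
    simp [φ, coord₁]
  let g : T ⟶ Y₁ a b c := toSpec (R := .of (R₁ a b c)) φ
  have hg (i) : pull g (coord₁ a b c i) = v i := by
    rw [pull_toSpec, hφ]
  have hr : Set.range g ⊆ Set.range (awayOrigin a b c).ι := by
    rintro _ ⟨t, rfl⟩
    rw [Scheme.Opens.range_ι]
    intro (hc : g t ∈ PrimeSpectrum.zeroLocus (Set.range (coord₁ a b c)))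
    rcases hne t with ht | ht
    · rw [← hg, mem_basicOpen_pull] at ht
      exact ht (hc ⟨0, rfl⟩)
    · rw [← hg, mem_basicOpen_pull] at ht
      exact ht (hc ⟨1, rfl⟩)
  refine ⟨IsOpenImmersion.lift (awayOrigin a b c).ι g hr, ?_, fun i => ?_⟩
  · rw [X₁str, IsOpenImmersion.lift_fac_assoc]
    refine pull_injective (RingHom.ext fun z => ?_)
    rw [pull_comp_SpecMap, pull_toSpec]
    exact (Ideal.Quotient.lift_mk _ _ _).trans (MvPolynomial.eval₂Hom_C _ _ _)
  · rw [crd₁, IsOpenImmersion.lift_fac, hg]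

end

/-! ### Curves `𝔸¹ ⟶ Xₙ` -/

/-- The structure morphism of the affine line over `ℂ`. -/
abbrev A1str : A1 (Spec (.of ℂ)) ⟶ Spec (.of ℂ) := A1 (Spec (.of ℂ)) ↘ Spec (.of ℂ)

open Polynomial in
/-- A polynomial as a function on the affine line. -/
def polyFun : ℂ[X] →+* Γ(A1 (Spec (.of ℂ)), ⊤) :=
  eval₂RingHom (pull A1str) (AffineSpace.coord _ PUnit.unit)

open Polynomial in
lemma polyFun_C (z : ℂ) : polyFun (C z) = pull A1str z := by
  simp [polyFun]

lemma polyFun_surjective : Function.Surjective polyFun := by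
  intro v
  let e := AffineSpace.SpecIso PUnit.{1} (.of ℂ)
  let i := (Scheme.ΓSpecIso (.of (MvPolynomial PUnit.{1} ℂ)))
  have key (p : Polynomial ℂ) :
      e.inv.appTop (polyFun p) = i.inv ((MvPolynomial.uniqueAlgEquiv ℂ PUnit.{1}).symm p) := by
    change (e.inv.appTop.hom.comp polyFun) p =
      (i.inv.hom.comp (MvPolynomial.uniqueAlgEquiv ℂ PUnit.{1}).symm.toAlgHom.toRingHom) p
    congr 1
    refine Polynomial.ringHom_ext (fun z => ?_) ?_
    · rw [RingHom.comp_apply, polyFun_C]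
      have h1 := pull_comp e.inv A1str z
      rw [AffineSpace.SpecIso_inv_over] at h1
      refine h1.symm.trans ?_
      have h2 := pull_comp_SpecMap (𝟙 _) (CommRingCat.ofHom (MvPolynomial.C (σ := PUnit.{1}) (R := ℂ))) z
      rw [Category.id_comp] at h2
      rw [h2]
      simp [pull]
      rfl
    · rw [RingHom.comp_apply]
      have : polyFun Polynomial.X = AffineSpace.coord _ PUnit.unit := by simp [polyFun]
      rw [this]
      refine (AffineSpace.SpecIso_inv_appTop_coord _ _).trans ?_
      simp
      rfl
  refine ⟨MvPolynomial.uniqueAlgEquiv ℂ PUnit.{1} (i.hom (e.inv.appTop v)), ?_⟩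
  have : IsIso (Scheme.Hom.appTop e.inv) := inferInstanceAs (IsIso (Scheme.Hom.app e.inv ⊤))
  refine ((ConcreteCategory.isIso_iff_bijective e.inv.appTop).1 this).1 ?_
  rw [key, AlgEquiv.symm_apply_apply]
  exact CommRingCat.inv_hom_apply i _

/-- A constant as a function on `Spec ℂ`. -/
abbrev cst : ℂ →+* Γ(Spec (.of ℂ), ⊤) := pull (R := .of ℂ) (𝟙 _)

lemma cst_eq (z : ℂ) : cst z = (Scheme.ΓSpecIso (.of ℂ)).inv z := by
  simp [cst, pull]

lemma cst_surjective : Function.Surjective cst := fun v =>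
  ⟨(Scheme.ΓSpecIso (.of ℂ)).hom v, (cst_eq _).trans (CommRingCat.inv_hom_apply _ _)⟩

lemma cst_injective : Function.Injective cst := fun z w h => by
  rw [cst_eq, cst_eq] at h
  exact ((ConcreteCategory.isIso_iff_bijective (Scheme.ΓSpecIso (.of ℂ)).inv).1 inferInstance).1 h

open Polynomial in
lemma appTop_polyFun {s : Spec (.of ℂ) ⟶ A1 (Spec (.of ℂ))} (hs : s ≫ A1str = 𝟙 _) {t : ℂ}
    (ht : crd s = cst t) (p : ℂ[X]) : s.appTop (polyFun p) = cst (p.eval t) := by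
  change (s.appTop.hom.comp polyFun) p = (cst.comp (evalRingHom t)) p
  congr 1
  refine Polynomial.ringHom_ext (fun z => ?_) ?_
  · rw [RingHom.comp_apply, polyFun_C]
    refine (pull_comp s A1str z).symm.trans ?_
    rw [hs, RingHom.comp_apply, coe_evalRingHom, eval_C]
  · rw [RingHom.comp_apply]
    have : polyFun Polynomial.X = AffineSpace.coord _ PUnit.unit := by simp [polyFun]
    rw [this]
    refine ht.trans ?_
    simp

lemma exists_section (t : ℂ) : ∃ s : Spec (.of ℂ) ⟶ A1 (Spec (.of ℂ)), s ≫ A1str = 𝟙 _ ∧ crd s = cst t :=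
  ⟨AffineSpace.homOfVector (𝟙 _) fun _ => cst t, AffineSpace.homOfVector_over _ _,
    crd_homOfVector _ _⟩

lemma polyFun_injective : Function.Injective polyFun := by
  intro p q h
  refine Polynomial.funext fun t => ?_
  obtain ⟨s, hs, ht⟩ := exists_section t
  have := congr(s.appTop $h)
  rw [appTop_polyFun hs ht, appTop_polyFun hs ht] at this
  exact cst_injective this

/-- A morphism from the affine line is constant if it takes the same value at all rational points. -/
def IsConst {Z : Scheme.{0}} (h : A1 (Spec (.of ℂ)) ⟶ Z) : Prop :=
  ∀ s s' : Spec (.of ℂ) ⟶ A1 (Spec (.of ℂ)), s ≫ A1str = 𝟙 _ → s' ≫ A1str = 𝟙 _ → s ≫ h = s' ≫ h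

open Polynomial in
lemma appTop_eq_of_eq_C {v : Γ(A1 (Spec (.of ℂ)), ⊤)} {d : ℂ} (hv : v = polyFun (C d))
    {s : Spec (.of ℂ) ⟶ A1 (Spec (.of ℂ))} (hs : s ≫ A1str = 𝟙 _) : s.appTop v = cst d := by
  obtain ⟨t, ht⟩ := cst_surjective (crd s)
  rw [hv, appTop_polyFun hs ht.symm, eval_C]

open Polynomial in
lemma exists_eq_C_of_isConst {g : A1 (Spec (.of ℂ)) ⟶ A1 (Spec (.of ℂ))} (hg : IsConst g) :
    ∃ d, crd g = polyFun (C d) := by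
  obtain ⟨p, hp⟩ := polyFun_surjective (crd g)
  refine ⟨p.eval 0, ?_⟩
  rw [← hp]
  congr 1
  refine Polynomial.funext fun t => cst_injective ?_
  obtain ⟨s, hs, hst⟩ := exists_section t
  obtain ⟨s', hs', hst'⟩ := exists_section 0
  rw [eval_C, ← appTop_polyFun hs hst, ← appTop_polyFun hs' hst', hp, ← crd_comp, ← crd_comp,
    hg s s' hs hs']

section

variable {a b c : ℂ}

open Polynomial in
/-- Curves `𝔸¹ ⟶ X₁` have constant coordinate `x₁`. -/
lemma exists_crd₁_one_eq_C (hab : a ≠ b) (hac : a ≠ c) (hbc : b ≠ c)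
    {h : A1 (Spec (.of ℂ)) ⟶ X₁ a b c} (hh : h ≫ X₁str a b c = A1str) :
    ∃ d, crd₁ h 1 = polyFun (C d) := by
  choose p hp using fun i => polyFun_surjective (crd₁ h i)
  have heq := crd₁_eq h
  rw [hh, ← hp, ← hp, ← hp, ← polyFun_C, ← polyFun_C, ← polyFun_C] at heq
  obtain ⟨d, hd⟩ := exists_eq_C_of_curve hab hac hbc (x₀ := p 0) (x₁ := p 1) (y := p 2)
    (polyFun_injective (by simpa only [map_mul, map_pow, map_sub] using heq)) (by
      intro t ht
      obtain ⟨s, hs, hst⟩ := exists_section t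
      rcases crd₁_ne (s ≫ h) (IsLocalRing.closedPoint ℂ) with h1 | h1
      · rw [crd₁_comp, ← hp, appTop_polyFun hs hst, ht.1, map_zero, Scheme.basicOpen_zero] at h1
        exact h1
      · rw [crd₁_comp, ← hp, appTop_polyFun hs hst, ht.2, map_zero, Scheme.basicOpen_zero] at h1
        exact h1)
  exact ⟨d, by rw [← hd, hp]⟩

lemma isConst_psi (hab : a ≠ b) (hac : a ≠ c) (hbc : b ≠ c)
    {h : A1 (Spec (.of ℂ)) ⟶ X₁ a b c} (hh : h ≫ X₁str a b c = A1str) :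
    IsConst (h ≫ ψ₁ a b c) := by
  intro s s' hs hs'
  obtain ⟨d, hd⟩ := exists_crd₁_one_eq_C hab hac hbc hh
  refine A1_hom_ext ?_ ?_
  · simp only [Category.assoc, proj₁_over, hh]
    rw [hs, hs']
  · rw [crd_comp s, crd_comp s', crd_proj₁, appTop_eq_of_eq_C hd hs, appTop_eq_of_eq_C hd hs']

open Polynomial in
/-- A curve `𝔸¹ ⟶ X₁` with constant `x₀` is constant, since `y₁²` is then constant. -/
lemma isConst_of_phi (hab : a ≠ b) (hac : a ≠ c) (hbc : b ≠ c)
    {h : A1 (Spec (.of ℂ)) ⟶ X₁ a b c} (hh : h ≫ X₁str a b c = A1str)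
    (h0 : IsConst (h ≫ φ₁ a b c)) : IsConst h := by
  obtain ⟨d, hd⟩ := exists_crd₁_one_eq_C hab hac hbc hh
  obtain ⟨e, he⟩ := exists_eq_C_of_isConst h0
  rw [crd_proj₁] at he
  obtain ⟨p, hp⟩ := polyFun_surjective (crd₁ h 2)
  have heq := crd₁_eq h
  rw [hh, ← hp, hd, he, ← polyFun_C, ← polyFun_C, ← polyFun_C] at heq
  have heq' : p ^ 2 = C (e ^ 2 * ((d - a) * (d - b) * (d - c))) :=
    polyFun_injective (by simpa only [map_mul, map_pow, map_sub] using heq)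
  have hdeg : p.natDegree = 0 := by
    have := congr(natDegree $heq')
    rw [natDegree_pow, natDegree_C] at this
    omega
  have hp' : crd₁ h 2 = polyFun (C (p.coeff 0)) := by
    rw [← hp, ← eq_C_of_natDegree_eq_zero hdeg]
  intro s s' hs hs'
  refine X₁_ext ?_ fun i => ?_
  · rw [Category.assoc, Category.assoc, hh, hs, hs']
  · rw [crd₁_comp, crd₁_comp]
    fin_cases i
    · exact (appTop_eq_of_eq_C he hs).trans (appTop_eq_of_eq_C he hs').symm
    · exact (appTop_eq_of_eq_C hd hs).trans (appTop_eq_of_eq_C hd hs').symm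
    · exact (appTop_eq_of_eq_C hp' hs).trans (appTop_eq_of_eq_C hp' hs').symm

variable (a b c) in
/-- The projection of the fibre product to its first factor. -/
abbrev towerFst (n : ℕ) : (tower a b c (n + 1)).left ⟶ X₁ a b c :=
  pullback.fst (ψ₁ a b c) (tower a b c n).hom

variable (a b c) in
/-- The projection of the fibre product forgetting the first factor. -/
abbrev towerSnd (n : ℕ) : (tower a b c (n + 1)).left ⟶ (tower a b c n).left :=
  pullback.snd (ψ₁ a b c) (tower a b c n).hom

lemma tower_condition (n : ℕ) :
    towerFst a b c n ≫ ψ₁ a b c = towerSnd a b c n ≫ (tower a b c n).hom :=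
  pullback.condition

lemma tower_succ_hom (n : ℕ) : (tower a b c (n + 1)).hom = towerFst a b c n ≫ φ₁ a b c := rfl

variable (a b c) in
/-- The structure morphism of the fibre product. -/
abbrev towerStr (n : ℕ) : (tower a b c n).left ⟶ Spec (.of ℂ) := (tower a b c n).hom ≫ A1str

lemma towerStr_succ (n : ℕ) : towerStr a b c (n + 1) = towerFst a b c n ≫ X₁str a b c := by
  rw [towerStr, tower_succ_hom, Category.assoc, proj₁_over]

lemma towerSnd_towerStr (n : ℕ) :
    towerSnd a b c n ≫ towerStr a b c n = towerStr a b c (n + 1) := by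
  rw [towerStr_succ, towerStr, ← Category.assoc, ← tower_condition, Category.assoc, proj₁_over]

lemma tower_hom_ext {n : ℕ} {T : Scheme.{0}} {f g : T ⟶ (tower a b c (n + 1)).left}
    (h1 : f ≫ towerFst a b c n = g ≫ towerFst a b c n)
    (h2 : f ≫ towerSnd a b c n = g ≫ towerSnd a b c n) : f = g :=
  pullback.hom_ext h1 h2

/-- A curve in `Xₙ` with constant first coordinate is constant. -/
lemma isConst_of_tower_hom (hab : a ≠ b) (hac : a ≠ c) (hbc : b ≠ c) (n : ℕ)
    {h : A1 (Spec (.of ℂ)) ⟶ (tower a b c n).left} (hh : h ≫ towerStr a b c n = A1str)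
    (h0 : IsConst (h ≫ (tower a b c n).hom)) : IsConst h := by
  induction n with
  | zero =>
    intro s s' hs hs'
    exact (congrArg (s ≫ ·) (Category.comp_id h)).symm.trans
      ((h0 s s' hs hs').trans (congrArg (s' ≫ ·) (Category.comp_id h)))
  | succ n ih =>
    have hh1 : (h ≫ towerFst a b c n) ≫ X₁str a b c = A1str := by
      rw [← hh, towerStr_succ, Category.assoc]
    have h1 : IsConst (h ≫ towerFst a b c n) :=
      isConst_of_phi hab hac hbc hh1 (by rwa [Category.assoc])
    have h2 : IsConst (h ≫ towerSnd a b c n) := by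
      refine ih ?_ ?_
      · rw [Category.assoc, towerSnd_towerStr, hh]
      · rw [Category.assoc, ← tower_condition, ← Category.assoc]
        exact isConst_psi hab hac hbc hh1
    intro s s' hs hs'
    refine tower_hom_ext ?_ ?_
    · rw [Category.assoc, Category.assoc]
      exact h1 s s' hs hs'
    · rw [Category.assoc, Category.assoc]
      exact h2 s s' hs hs'

/-- The image in `Xₙ` of a curve in `Xₙ₊₁` is constant: its first coordinate is the coordinate `x₁`
of a curve in `X₁`. -/
lemma isConst_towerSnd (hab : a ≠ b) (hac : a ≠ c) (hbc : b ≠ c) (n : ℕ)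
    {h : A1 (Spec (.of ℂ)) ⟶ (tower a b c (n + 1)).left}
    (hh : h ≫ towerStr a b c (n + 1) = A1str) : IsConst (h ≫ towerSnd a b c n) := by
  refine isConst_of_tower_hom hab hac hbc n ?_ ?_
  · rw [Category.assoc, towerSnd_towerStr, hh]
  · rw [Category.assoc, ← tower_condition, ← Category.assoc]
    refine isConst_psi hab hac hbc ?_
    rw [← hh, towerStr_succ, Category.assoc]

end

/-! ### The retraction `𝒮(Xₙ₊₁) ⟶ Xₙ` -/

section

variable {a b c : ℂ}

instance : IsSeparated (X₁str a b c) := by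
  rw [X₁str]
  infer_instance

instance : LocallyOfFiniteType (X₁str a b c) := by
  have : LocallyOfFiniteType (Spec.map (CommRingCat.ofHom (algebraMap ℂ (R₁ a b c)))) := by
    rw [HasRingHomProperty.Spec_iff (P := @LocallyOfFiniteType)]
    change RingHom.FiniteType (algebraMap ℂ (R₁ a b c))
    rw [RingHom.finiteType_algebraMap]
    infer_instance
  rw [X₁str]
  infer_instance

instance : QuasiCompact (X₁str a b c) := by
  have : IsLocallyNoetherian (Y₁ a b c) := inferInstance
  rw [X₁str]
  infer_instance

instance (i : Fin 3) : IsSeparated (proj₁ a b c i) := by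
  have : IsSeparated (proj₁ a b c i ≫ A1str) := by
    rw [proj₁_over]
    infer_instance
  exact IsSeparated.of_comp _ A1str

instance (i : Fin 3) : LocallyOfFiniteType (proj₁ a b c i) := by
  have : LocallyOfFiniteType (proj₁ a b c i ≫ A1str) := by
    rw [proj₁_over]
    infer_instance
  exact locallyOfFiniteType_of_comp _ A1str

instance (i : Fin 3) : QuasiCompact (proj₁ a b c i) := by
  have : QuasiCompact (proj₁ a b c i ≫ A1str) := by
    rw [proj₁_over]
    infer_instance
  exact QuasiCompact.of_comp _ A1str

lemma tower_hom_props (n : ℕ) : IsSeparated (tower a b c n).hom ∧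
    LocallyOfFiniteType (tower a b c n).hom ∧ QuasiCompact (tower a b c n).hom := by
  induction n with
  | zero => exact ⟨inferInstanceAs (IsSeparated (𝟙 _)), inferInstanceAs (LocallyOfFiniteType (𝟙 _)),
      inferInstanceAs (QuasiCompact (𝟙 _))⟩
  | succ n ih =>
    obtain ⟨_, _, _⟩ := ih
    exact ⟨inferInstanceAs (IsSeparated (pullback.fst (ψ₁ a b c) (tower a b c n).hom ≫ φ₁ a b c)),
      inferInstanceAs (LocallyOfFiniteType (pullback.fst (ψ₁ a b c) (tower a b c n).hom ≫ φ₁ a b c)),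
      inferInstanceAs (QuasiCompact (pullback.fst (ψ₁ a b c) (tower a b c n).hom ≫ φ₁ a b c))⟩

instance (n : ℕ) : IsSeparated (tower a b c n).hom := (tower_hom_props n).1
instance (n : ℕ) : LocallyOfFiniteType (tower a b c n).hom := (tower_hom_props n).2.1
instance (n : ℕ) : QuasiCompact (tower a b c n).hom := (tower_hom_props n).2.2

end

/-- A morphism of schemes over `k` as a map of functors of points. -/
def pointsMap {k : Type} [Field k] {X Y : Over (Spec (.of k))} (f : X ⟶ Y) : points X ⟶ points Y :=
  Functor.whiskerLeft _ (Functor.whiskerRight (yoneda.map f) uliftFunctor.{1, 0})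

/-- Two morphisms from a smooth scheme to a separated scheme of finite type over `ℂ` agree if they
agree on `ℂ`-points. -/
lemma hom_ext_of_points {U Y : Scheme.{0}} (q : U ⟶ Spec (.of ℂ)) [Smooth q] (i : Y ⟶ Spec (.of ℂ))
    [IsSeparated i] [LocallyOfFiniteType i] {f g : U ⟶ Y} (hf : f ≫ i = q) (hg : g ≫ i = q)
    (h : ∀ u : Spec (.of ℂ) ⟶ U, u ≫ q = 𝟙 _ → u ≫ f = u ≫ g) : f = g := by
  have : IsReduced U := isReduced_of_smooth q
  have : LocallyOfFiniteType (f ≫ i) := by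
    rw [hf]
    infer_instance
  refine ext_of_apply_eq i Set.univ isClosed_univ.isLocallyClosed dense_univ ?_ (hf.trans hg.symm)
  intro x _ hx
  have hu := pointOfClosedPoint_apply q x hx (IsLocalRing.closedPoint ℂ)
  rw [← hu]
  exact congr($(h _ (pointOfClosedPoint_comp q x hx)) (IsLocalRing.closedPoint ℂ))

/-- The section of the affine line over `U` determined by a function on `U`. -/
abbrev sec (U : Scheme.{0}) (t : Γ(U, ⊤)) : U ⟶ A1 U := AffineSpace.homOfVector (𝟙 U) fun _ => t

lemma comp_sec {U V : Scheme.{0}} (f : V ⟶ U) (t : Γ(U, ⊤)) :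
    f ≫ sec U t = sec V (f.appTop t) ≫ AffineSpace.map _ f := by
  refine A1_hom_ext (by simp) ?_
  rw [crd_comp, crd_homOfVector, crd_comp]
  refine Eq.symm ((congrArg _ (AffineSpace.map_appTop_coord f PUnit.unit)).trans ?_)
  exact crd_homOfVector _ _

/-- `𝔸¹`-homotopies in `Xₙ₊₁` become constant in `Xₙ`. -/
lemma sec_comp_towerSnd {a b c : ℂ} (hab : a ≠ b) (hac : a ≠ c) (hbc : b ≠ c) (n : ℕ)
    {U : Scheme.{0}} (q : U ⟶ Spec (.of ℂ)) [Smooth q] {H : A1 U ⟶ (tower a b c (n + 1)).left}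
    (hH : H ≫ towerStr a b c (n + 1) = (A1 U ↘ U) ≫ q) :
    sec U 0 ≫ H ≫ towerSnd a b c n = sec U 1 ≫ H ≫ towerSnd a b c n := by
  refine hom_ext_of_points q (towerStr a b c n) ?_ ?_ fun u hu => ?_
  · rw [Category.assoc, Category.assoc, towerSnd_towerStr, hH, AffineSpace.homOfVector_over_assoc,
      Category.id_comp]
  · rw [Category.assoc, Category.assoc, towerSnd_towerStr, hH, AffineSpace.homOfVector_over_assoc,
      Category.id_comp]
  · have hc : IsConst ((AffineSpace.map _ u ≫ H) ≫ towerSnd a b c n) := by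
      refine isConst_towerSnd hab hac hbc n ?_
      rw [Category.assoc, hH, AffineSpace.map_over_assoc, hu, Category.comp_id]
    have := hc (sec _ 0) (sec _ 1) (AffineSpace.homOfVector_over _ _)
      (AffineSpace.homOfVector_over _ _)
    have h0 := comp_sec u 0
    have h1 := comp_sec u 1
    rw [map_zero] at h0
    rw [map_one] at h1
    rw [reassoc_of% h0, reassoc_of% h1]
    simpa only [Category.assoc] using this

section

variable (a b c : ℂ)

/-- The projection `Xₙ₊₁ ⟶ Xₙ` forgetting the first factor, as a morphism over `ℂ`. -/
def dropFirst (n : ℕ) : Xn a b c (n + 1) ⟶ Xn a b c n :=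
  Over.homMk (towerSnd a b c n) (towerSnd_towerStr n)

variable {a b c}

lemma pointsMap_dropFirst_homotopy (hab : a ≠ b) (hac : a ≠ c) (hbc : b ≠ c) (n : ℕ) (U : Sm ℂ)
    (h : (points (Xn a b c (n + 1))).obj (op (cyl.obj U))) :
    (pointsMap (dropFirst a b c n)).app (op U) ((points _).map (sect U 0).op h) =
      (pointsMap (dropFirst a b c n)).app (op U) ((points _).map (sect U 1).op h) := by
  have : Smooth U.hom := U.prop.1
  refine ULift.ext _ _ (Over.OverMorphism.ext ?_)
  exact (Category.assoc _ _ _).trans ((sec_comp_towerSnd hab hac hbc n U.hom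
    (H := h.down.left) (Over.w h.down)).trans (Category.assoc _ _ _).symm)

/-- The map `𝒮(Xₙ₊₁) ⟶ Xₙ` induced by forgetting the first factor. -/
def naiveDropFirst (hab : a ≠ b) (hac : a ≠ c) (hbc : b ≠ c) (n : ℕ) :
    naive (points (Xn a b c (n + 1))) ⟶ points (Xn a b c n) :=
  naiveDesc (isSheaf_points _) (pointsMap (dropFirst a b c n))
    (pointsMap_dropFirst_homotopy hab hac hbc n)

end

/-! ### Units and vanishing loci -/

lemma isUnit_iff_forall_mem_basicOpen {T : Scheme.{0}} {v : Γ(T, ⊤)} :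
    IsUnit v ↔ ∀ t : T, t ∈ T.basicOpen v := by
  refine ⟨fun h t => by rw [Scheme.basicOpen_of_isUnit _ h]; trivial, fun h => ?_⟩
  refine RingedSpace.isUnit_of_isUnit_germ T.toRingedSpace ⊤ v fun t ht => ?_
  exact (Scheme.mem_basicOpen_top T v t).1 (h t)

lemma mem_basicOpen_appTop {T T' : Scheme.{0}} (f : T' ⟶ T) (v : Γ(T, ⊤)) (t : T') :
    t ∈ T'.basicOpen (f.appTop v) ↔ f t ∈ T.basicOpen v := by
  rw [← Scheme.preimage_basicOpen_top]
  rfl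

lemma mem_basicOpen_iff {T : Scheme.{0}} (v : Γ(T, ⊤)) (t : T) :
    t ∈ T.basicOpen v ↔ T.evaluation ⊤ t trivial v ≠ 0 :=
  (Scheme.evaluation_ne_zero_iff_mem_basicOpen (U := ⊤) T t trivial v).symm

/-! ### Lifting points of `Xₙ` to `Xₙ₊₁` -/

section

variable {a b c : ℂ} {n : ℕ} {T : Scheme.{0}}

/-- The first coordinate of a point of `Xₙ`. -/
def towerCrd (α : T ⟶ (tower a b c n).left) : Γ(T, ⊤) := crd (α ≫ (tower a b c n).hom)

lemma towerCrd_comp {T' : Scheme.{0}} (g : T' ⟶ T) (α : T ⟶ (tower a b c n).left) :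
    towerCrd (g ≫ α) = g.appTop (towerCrd α) := by
  rw [towerCrd, Category.assoc, crd_comp, towerCrd]

lemma crd₁_towerFst_one (β : T ⟶ (tower a b c (n + 1)).left) :
    crd₁ (β ≫ towerFst a b c n) 1 = towerCrd (β ≫ towerSnd a b c n) := by
  rw [← crd_proj₁, towerCrd, Category.assoc, tower_condition, Category.assoc]

/-- A point of `Xₙ₊₁` is determined by its image in `Xₙ` and the coordinates `x₀`, `y` of its first
factor. -/
lemma tower_ext {β β' : T ⟶ (tower a b c (n + 1)).left}
    (h : β ≫ towerSnd a b c n = β' ≫ towerSnd a b c n)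
    (h0 : crd₁ (β ≫ towerFst a b c n) 0 = crd₁ (β' ≫ towerFst a b c n) 0)
    (h2 : crd₁ (β ≫ towerFst a b c n) 2 = crd₁ (β' ≫ towerFst a b c n) 2) : β = β' := by
  refine tower_hom_ext (X₁_ext ?_ fun i => ?_) h
  · rw [Category.assoc, Category.assoc, ← towerStr_succ, ← towerSnd_towerStr, ← Category.assoc, h,
      Category.assoc]
  · fin_cases i
    · exact h0
    · exact (crd₁_towerFst_one β).trans ((congrArg towerCrd h).trans (crd₁_towerFst_one β').symm)
    · exact h2

lemma crd₁_towerFst_sq (β : T ⟶ (tower a b c (n + 1)).left) :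
    crd₁ (β ≫ towerFst a b c n) 2 ^ 2 = crd₁ (β ≫ towerFst a b c n) 0 ^ 2 *
      ((towerCrd (β ≫ towerSnd a b c n) - pull (β ≫ towerStr a b c (n + 1)) a) *
        (towerCrd (β ≫ towerSnd a b c n) - pull (β ≫ towerStr a b c (n + 1)) b) *
        (towerCrd (β ≫ towerSnd a b c n) - pull (β ≫ towerStr a b c (n + 1)) c)) := by
  rw [towerStr_succ, ← Category.assoc, ← crd₁_towerFst_one]
  exact crd₁_eq _

/-- A point of `Xₙ` with first coordinate `x` and functions `x₀`, `y` with `y² = x₀² f(x)`, such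
that `x₀` and `x` have no common zero, determine a point of `Xₙ₊₁`. -/
lemma exists_lift_tower (α : T ⟶ (tower a b c n).left) (x₀ y : Γ(T, ⊤))
    (h : y ^ 2 = x₀ ^ 2 * ((towerCrd α - pull (α ≫ towerStr a b c n) a) *
      (towerCrd α - pull (α ≫ towerStr a b c n) b) * (towerCrd α - pull (α ≫ towerStr a b c n) c)))
    (hne : ∀ t : T, t ∈ T.basicOpen x₀ ∨ t ∈ T.basicOpen (towerCrd α)) :
    ∃ β : T ⟶ (tower a b c (n + 1)).left, β ≫ towerSnd a b c n = α ∧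
      crd₁ (β ≫ towerFst a b c n) 0 = x₀ ∧ crd₁ (β ≫ towerFst a b c n) 2 = y := by
  obtain ⟨f, hf, hfv⟩ := exists_toX₁ (α ≫ towerStr a b c n) ![x₀, towerCrd α, y] h hne
  have hw : f ≫ ψ₁ a b c = α ≫ (tower a b c n).hom := by
    refine A1_hom_ext ?_ ?_
    · rw [Category.assoc, proj₁_over, hf, Category.assoc]
    · rw [crd_proj₁, hfv]
      rfl
  let β : T ⟶ (tower a b c (n + 1)).left := pullback.lift f α hw
  have h1 : β ≫ towerFst a b c n = f := pullback.lift_fst _ _ _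
  refine ⟨β, pullback.lift_snd _ _ _, ?_, ?_⟩
  · rw [h1, hfv]
    rfl
  · rw [h1, hfv]
    rfl

/-- If the first coordinate `x` of `α` is invertible, any point of `Xₙ₊₁` over `α` is homotopic to
the one with `x₀ = y = 0`, through the points `(s x₀, x, s y)`. -/
lemma exists_homotopy_zero (β : T ⟶ (tower a b c (n + 1)).left)
    (hx : IsUnit (towerCrd (β ≫ towerSnd a b c n))) :
    ∃ H : A1 T ⟶ (tower a b c (n + 1)).left, H ≫ towerStr a b c (n + 1) =
        (A1 T ↘ T) ≫ β ≫ towerStr a b c (n + 1) ∧ sec T 1 ≫ H = β ∧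
      (sec T 0 ≫ H) ≫ towerSnd a b c n = β ≫ towerSnd a b c n ∧
      crd₁ ((sec T 0 ≫ H) ≫ towerFst a b c n) 0 = 0 ∧
      crd₁ ((sec T 0 ≫ H) ≫ towerFst a b c n) 2 = 0 := by
  let s : Γ(A1 T, ⊤) := AffineSpace.coord T PUnit.unit
  let π : A1 T ⟶ T := A1 T ↘ T
  obtain ⟨H, hH, hH0, hH2⟩ := exists_lift_tower (π ≫ β ≫ towerSnd a b c n)
    (s * π.appTop (crd₁ (β ≫ towerFst a b c n) 0)) (s * π.appTop (crd₁ (β ≫ towerFst a b c n) 2)) (by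
      rw [mul_pow, ← map_pow, crd₁_towerFst_sq, towerCrd_comp π, Category.assoc, Category.assoc,
        towerSnd_towerStr, pull_comp π, pull_comp π, pull_comp π]
      simp only [map_mul, map_pow, map_sub]
      ring) (fun t => by
        right
        rw [towerCrd_comp, mem_basicOpen_appTop]
        exact isUnit_iff_forall_mem_basicOpen.1 hx _)
  have hs (e : Γ(T, ⊤)) : (sec T e).appTop s = e := crd_homOfVector _ _
  have hπ (e : Γ(T, ⊤)) : sec T e ≫ π = 𝟙 T := AffineSpace.homOfVector_over _ _
  have hπ' (e v : Γ(T, ⊤)) : (sec T e).appTop (π.appTop v) = v := by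
    have := congr(Scheme.Hom.appTop $(hπ e) v)
    rw [Scheme.Hom.comp_appTop] at this
    exact this.trans (by simp)
  have hsnd (e : Γ(T, ⊤)) : (sec T e ≫ H) ≫ towerSnd a b c n = β ≫ towerSnd a b c n := by
    rw [Category.assoc, hH, ← Category.assoc, hπ, Category.id_comp]
  have h0 (e : Γ(T, ⊤)) : crd₁ ((sec T e ≫ H) ≫ towerFst a b c n) 0 =
      e * crd₁ (β ≫ towerFst a b c n) 0 := by
    rw [Category.assoc, crd₁_comp, hH0, map_mul, hs, hπ']
  have h2 (e : Γ(T, ⊤)) : crd₁ ((sec T e ≫ H) ≫ towerFst a b c n) 2 =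
      e * crd₁ (β ≫ towerFst a b c n) 2 := by
    rw [Category.assoc, crd₁_comp, hH2, map_mul, hs, hπ']
  refine ⟨H, ?_, tower_ext (hsnd 1) (by rw [h0, one_mul]) (by rw [h2, one_mul]), hsnd 0,
    by rw [h0, zero_mul], by rw [h2, zero_mul]⟩
  rw [← towerSnd_towerStr, ← Category.assoc, hH]
  simp only [π, Category.assoc]

end

/-! ### An étale square root of `f` near `0` -/

/-- A section of a morphism induces bijections on residue fields. -/
lemma bijective_residueFieldMap_section {S T : Scheme.{0}} {s : S ⟶ T} {g : T ⟶ S}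
    (h : s ≫ g = 𝟙 S) (x : S) : Function.Bijective (s.residueFieldMap x) := by
  have h1 : Function.Bijective ((s ≫ g).residueFieldMap x) := by
    have (e : S ⟶ S) (he : e = 𝟙 S) : Function.Bijective (e.residueFieldMap x) := by
      subst he
      rw [Scheme.residueFieldMap_id]
      exact Function.bijective_id
    exact this _ h
  rw [Scheme.residueFieldMap_comp] at h1
  exact ⟨RingHom.injective _, Function.Surjective.of_comp h1.2⟩

open Polynomial in
/-- The standard étale pair `(T² - u, T (T + v))`, where `2` is invertible: it adjoins an
invertible square root of `u` that is different from `-v`. -/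
def sqrtPair {R : Type} [CommRing R] (u v w : R) (hw : w * 2 = 1) : StandardEtalePair R where
  f := X ^ 2 - C u
  monic_f := monic_X_pow_sub_C _ two_ne_zero
  g := X * (X + C v)
  cond := by
    refine ⟨C w * (X + C v), 0, 1, ?_⟩
    have hw' : (C w : R[X]) * C 2 = 1 := by
      rw [← C_mul, hw, C_1]
    simp only [derivative_sub, derivative_X_pow, derivative_C, Nat.cast_ofNat]
    linear_combination (X * (X + C v)) * hw'

/-- An étale neighbourhood `E` of the origin of `𝔸¹`, with the same residue field, on which `f` has a
square root `t` with value `t₀` at the origin. Moreover `t` is nowhere equal to `-t₀`, so that all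
zeros of the coordinate on `E` lie on the branch of `t₀`. -/
lemma exists_etale_sqrt {a b c t₀ : ℂ} (h0 : t₀ ^ 2 = (0 - a) * (0 - b) * (0 - c)) (ht : t₀ ≠ 0) :
    ∃ (E : Scheme.{0}) (e : E ⟶ A1 (Spec (.of ℂ))) (v : E) (t : Γ(E, ⊤)), Etale e ∧ QuasiCompact e ∧
      (∃ o : Spec (.of ℂ), e v = sec (Spec (.of ℂ)) 0 o) ∧
      Function.Bijective (e.residueFieldMap v) ∧
      t ^ 2 = (crd e - pull (e ≫ A1str) a) * (crd e - pull (e ≫ A1str) b) *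
        (crd e - pull (e ≫ A1str) c) ∧ IsUnit (t + pull (e ≫ A1str) t₀) := by
  let R := Γ(A1 (Spec (.of ℂ)), ⊤)
  let x : R := AffineSpace.coord _ PUnit.unit
  let κ : ℂ →+* R := pull A1str
  let P : StandardEtalePair R := sqrtPair ((x - κ a) * (x - κ b) * (x - κ c)) (κ t₀) (κ (1 / 2))
    (by rw [← map_ofNat κ 2, ← map_mul]; norm_num)
  let j : R ⟶ .of P.Ring := CommRingCat.ofHom (algebraMap R P.Ring)
  let E : Scheme.{0} := Spec (.of P.Ring)
  let e : E ⟶ A1 (Spec (.of ℂ)) := Spec.map j ≫ (A1 (Spec (.of ℂ))).isoSpec.inv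
  have hj : Etale (Spec.map j) := by
    rw [HasRingHomProperty.Spec_iff (P := @Etale)]
    change RingHom.Etale (algebraMap R P.Ring)
    rw [RingHom.etale_algebraMap]
    infer_instance
  have he (r : R) : e.appTop r = pull (𝟙 E) (algebraMap R P.Ring r) := by
    have h1 : e ≫ (A1 (Spec (.of ℂ))).toSpecΓ = 𝟙 E ≫ Spec.map j := by
      have : (A1 (Spec (.of ℂ))).toSpecΓ = (A1 (Spec (.of ℂ))).isoSpec.hom := rfl
      rw [this, Category.assoc, Iso.inv_hom_id, Category.comp_id, Category.id_comp]
    have h2 := congr(pull $h1 r)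
    rw [pull_comp_SpecMap, pull_comp] at h2
    refine Eq.trans ?_ h2
    congr 1
    simp [pull, Scheme.toSpecΓ_appTop]
  have hcst (z : ℂ) : pull (e ≫ A1str) z = pull (𝟙 E) (algebraMap R P.Ring (κ z)) := by
    rw [pull_comp, he]
  have hcrd : crd e = pull (𝟙 E) (algebraMap R P.Ring x) := he x
  let o := sec (Spec (.of ℂ)) 0
  have hoκ (z : ℂ) : o.appTop (κ z) = cst z := by
    have := pull_comp o A1str z
    rw [AffineSpace.homOfVector_over] at this
    exact this.symm
  have hox : o.appTop x = 0 := crd_homOfVector _ _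
  let : Algebra R Γ(Spec (.of ℂ), ⊤) := o.appTop.hom.toAlgebra
  have halg (r : R) : algebraMap R Γ(Spec (.of ℂ), ⊤) r = o.appTop r := rfl
  -- The origin lifts to `E` by sending the square root to `t₀`.
  have hmap : P.HasMap (cst t₀) := by
    constructor
    · simp only [P, sqrtPair, map_sub, map_pow, Polynomial.aeval_X, Polynomial.aeval_C, halg,
        map_mul, hoκ, hox]
      rw [← map_pow, h0]
      simp
    · simp only [P, sqrtPair, map_mul, map_add, Polynomial.aeval_X, Polynomial.aeval_C, halg, hoκ]
      rw [← map_add, ← map_mul]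
      refine IsUnit.map _ (IsUnit.mk0 _ ?_)
      rw [← two_mul]
      exact mul_ne_zero ht (mul_ne_zero two_ne_zero ht)
  let z : Spec (.of ℂ) ⟶ E := toSpec (R := .of P.Ring) (P.lift _ hmap).toRingHom
  have hz : z ≫ e = o := by
    rw [← cancel_mono (A1 (Spec (.of ℂ))).isoSpec.hom]
    simp only [e, Category.assoc, Iso.inv_hom_id, Category.comp_id]
    refine pull_injective (RingHom.ext fun r => ?_)
    rw [pull_comp_SpecMap, pull_toSpec, pull_comp]
    refine ((P.lift _ hmap).commutes r).trans ?_
    rw [halg]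
    congr 1
    simp [pull, Scheme.isoSpec, Scheme.toSpecΓ_appTop]
  have ho : o ≫ A1str = 𝟙 _ := AffineSpace.homOfVector_over _ _
  let o' : ↥(Spec (CommRingCat.of ℂ)) := IsLocalRing.closedPoint ℂ
  refine ⟨E, e, z o', pull (𝟙 E) P.X, inferInstance, inferInstance,
    ⟨o', ?_⟩, ?_, ?_, ?_⟩
  · rw [← Scheme.Hom.comp_apply, hz]
  · have h1 : Function.Bijective ((z ≫ e).residueFieldMap o') :=
      bijective_residueFieldMap_section (g := A1str) (by rw [hz, ho]) _
    have h2 : Function.Bijective (z.residueFieldMap o') :=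
      bijective_residueFieldMap_section (g := e ≫ A1str) (by rw [← Category.assoc, hz, ho]) _
    rw [Scheme.residueFieldMap_comp] at h1
    exact (Function.Bijective.of_comp_iff' h2 _).1 h1
  · have h := P.hasMap_X.1
    change Polynomial.aeval P.X (Polynomial.X ^ 2 - Polynomial.C _) = 0 at h
    rw [map_sub, map_pow, Polynomial.aeval_X, Polynomial.aeval_C] at h
    rw [← map_pow, sub_eq_zero.1 h, hcst, hcst, hcst, hcrd]
    simp only [map_mul, map_sub]
  · have h := P.hasMap_X.2
    change IsUnit (Polynomial.aeval P.X (Polynomial.X * (Polynomial.X + Polynomial.C _))) at h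
    rw [map_mul, map_add, Polynomial.aeval_X, Polynomial.aeval_C] at h
    rw [hcst, ← map_add]
    exact (isUnit_of_mul_isUnit_right h).map _

/-! ### Open subschemes as Nisnevich coverings -/

section

variable {k : Type} [Field k]

/-- An open subscheme of an object of `Sm k`. -/
def openSub (U : Sm k) (W : U.left.Opens) : Sm k :=
  MorphismProperty.Over.mk ⊤ (W.ι ≫ U.hom) (by
    have : Smooth U.hom := U.prop.1
    have : QuasiCompact U.hom := U.prop.2
    have : IsLocallyNoetherian U.left :=
      LocallyOfFiniteType.isLocallyNoetherian (Y := Spec (.of k)) U.hom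
    exact ⟨inferInstance, inferInstance⟩)

/-- The inclusion of an open subscheme. -/
def openSubι (U : Sm k) (W : U.left.Opens) : openSub U W ⟶ U :=
  MorphismProperty.Over.homMk W.ι rfl trivial

lemma bijective_residueFieldMap_openSubι (U : Sm k) (W : U.left.Opens) (w : W.toScheme) :
    Function.Bijective ((openSubι U W).left.residueFieldMap w) :=
  (ConcreteCategory.isIso_iff_bijective (W.ι.residueFieldMap w)).1 inferInstance

lemma isNisnevichCovering_of_opens {U : Sm k} {S : Sieve U}
    (h : ∀ u : U.left, ∃ W : U.left.Opens, u ∈ W ∧ S (openSubι U W)) : IsNisnevichCovering S := by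
  intro u
  obtain ⟨W, hu, hW⟩ := h u
  exact ⟨_, _, hW, inferInstanceAs (Etale W.ι), ⟨u, hu⟩, rfl,
    bijective_residueFieldMap_openSubι U W _⟩

lemma isUnit_appTop_openSubι {U : Sm k} (v : Γ(U.left, ⊤)) :
    IsUnit ((openSubι U (U.left.basicOpen v)).left.appTop v) :=
  isUnit_iff_forall_mem_basicOpen.2 fun t =>
    (mem_basicOpen_appTop (U.left.basicOpen v).ι v t).2 t.2

end

/-! ### The section `Xₙ ⟶ 𝒮(Xₙ₊₁)` -/

section

variable {a b c : ℂ} {n : ℕ} {U V : Sm ℂ}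

/-- The morphism of schemes underlying a section of the functor of points of `Xₙ`. -/
def ptHom (α : (points (Xn a b c n)).obj (op U)) : U.left ⟶ (tower a b c n).left := α.down.left

lemma ptHom_comp_towerStr (α : (points (Xn a b c n)).obj (op U)) :
    ptHom α ≫ towerStr a b c n = U.hom := Over.w α.down

lemma pt_ext {α α' : (points (Xn a b c n)).obj (op U)} (h : ptHom α = ptHom α') : α = α' :=
  ULift.ext _ _ (Over.OverMorphism.ext h)

lemma exists_ptHom_eq {f : U.left ⟶ (tower a b c n).left} (h : f ≫ towerStr a b c n = U.hom) :
    ∃ α : (points (Xn a b c n)).obj (op U), ptHom α = f :=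
  ⟨⟨Over.homMk f h⟩, rfl⟩

lemma ptHom_map (f : V ⟶ U) (α : (points (Xn a b c n)).obj (op U)) :
    ptHom ((points (Xn a b c n)).map f.op α) = f.left ≫ ptHom α := rfl

lemma ptHom_dropFirst (β : (points (Xn a b c (n + 1))).obj (op U)) :
    ptHom ((pointsMap (dropFirst a b c n)).app (op U) β) = ptHom β ≫ towerSnd a b c n := rfl

/-- Where the first coordinate is invertible, all lifts of a point of `Xₙ` to `Xₙ₊₁` have the same
image in `𝒮(Xₙ₊₁)`. -/
lemma toNaive_eq_of_isUnit {β β' : (points (Xn a b c (n + 1))).obj (op U)}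
    (h : ptHom β ≫ towerSnd a b c n = ptHom β' ≫ towerSnd a b c n)
    (hx : IsUnit (towerCrd (ptHom β ≫ towerSnd a b c n))) :
    (toNaive _).app (op U) β = (toNaive _).app (op U) β' := by
  have key (γ : (points (Xn a b c (n + 1))).obj (op U))
      (hx : IsUnit (towerCrd (ptHom γ ≫ towerSnd a b c n))) :
      ∃ γ₀ : (points (Xn a b c (n + 1))).obj (op U),
        (toNaive _).app (op U) γ = (toNaive _).app (op U) γ₀ ∧
        ptHom γ₀ ≫ towerSnd a b c n = ptHom γ ≫ towerSnd a b c n ∧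
        crd₁ (ptHom γ₀ ≫ towerFst a b c n) 0 = 0 ∧ crd₁ (ptHom γ₀ ≫ towerFst a b c n) 2 = 0 := by
    obtain ⟨H, hH, hH1, hs, h0, h2⟩ := exists_homotopy_zero (ptHom γ) hx
    rw [ptHom_comp_towerStr] at hH
    obtain ⟨η, hη⟩ := exists_ptHom_eq (U := cyl.obj U) (f := H) hH
    have h0' : ptHom ((points (Xn a b c (n + 1))).map (sect U 0).op η) = sec U.left 0 ≫ H := by
      rw [ptHom_map, hη]
      rfl
    have h1' : ptHom ((points (Xn a b c (n + 1))).map (sect U 1).op η) = ptHom γ := by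
      rw [ptHom_map, hη]
      exact hH1
    refine ⟨(points _).map (sect U 0).op η, (toNaive_app_eq ⟨η, rfl, pt_ext h1'⟩).symm, ?_, ?_, ?_⟩
    · rw [h0', hs]
    · rw [h0', h0]
    · rw [h0', h2]
  obtain ⟨γ, hγ, hs, h0, h2⟩ := key β hx
  obtain ⟨γ', hγ', hs', h0', h2'⟩ := key β' (h ▸ hx)
  rw [hγ, hγ']
  congr 1
  exact pt_ext (tower_ext (by rw [hs, hs', h]) (by rw [h0, h0']) (by rw [h2, h2']))

/-- `IsGoodLift t₀ α τ`: the section `τ` of `𝒮(Xₙ₊₁)` is the image of a lift `β = (x₀, x, y)` of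
`α` such that the first coordinate `x` of `α` is invertible, or `x₀ = 1` and `y` is a square root of
`f(x)` that is nowhere equal to `-t₀`. -/
def IsGoodLift (t₀ : ℂ) (U : Sm ℂ) (α : (points (Xn a b c n)).obj (op U))
    (τ : (naive (points (Xn a b c (n + 1)))).obj (op U)) : Prop :=
  ∃ β : (points (Xn a b c (n + 1))).obj (op U), ptHom β ≫ towerSnd a b c n = ptHom α ∧
    (toNaive _).app (op U) β = τ ∧
    (IsUnit (towerCrd (ptHom α)) ∨ (crd₁ (ptHom β ≫ towerFst a b c n) 0 = 1 ∧
      IsUnit (crd₁ (ptHom β ≫ towerFst a b c n) 2 + pull (T := U.left) U.hom t₀)))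

lemma pull_hom_comp (f : V ⟶ U) (z : ℂ) :
    pull (T := V.left) V.hom z = f.left.appTop (pull (T := U.left) U.hom z) := by
  rw [← pull_comp, MorphismProperty.Over.w]

lemma IsGoodLift.map {t₀ : ℂ} (f : V ⟶ U) {α : (points (Xn a b c n)).obj (op U)}
    {τ : (naive (points (Xn a b c (n + 1)))).obj (op U)} (h : IsGoodLift t₀ U α τ) :
    IsGoodLift t₀ V ((points _).map f.op α) ((naive _).map f.op τ) := by
  obtain ⟨β, hβ, rfl, h⟩ := h
  refine ⟨(points _).map f.op β, ?_, NatTrans.naturality_apply (toNaive _) f.op β, ?_⟩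
  · rw [ptHom_map, ptHom_map, Category.assoc, hβ]
  · refine h.imp (fun h => ?_) fun ⟨h1, h2⟩ => ⟨?_, ?_⟩
    · rw [ptHom_map, towerCrd_comp]
      exact h.map _
    · rw [ptHom_map, Category.assoc, crd₁_comp, h1, map_one]
    · rw [ptHom_map, Category.assoc, crd₁_comp, pull_hom_comp f, ← map_add]
      exact h2.map _

lemma map_eq_map_of_sq_eq {A B : Type*} [CommRing A] [CommRing B] (φ : A →+* B) {y y' : A}
    (h : y ^ 2 = y' ^ 2) (hu : IsUnit (φ (y + y'))) : φ y = φ y' := by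
  refine sub_eq_zero.1 (hu.mul_left_eq_zero.1 ?_)
  rw [← map_sub, ← map_mul]
  have : (y - y') * (y + y') = 0 := by linear_combination h
  rw [this, map_zero]

/-- Two lifts of the same point with equal `x₀` have `y² = y'²`, so they agree where `y + y'` is
invertible. -/
lemma map_eq_map_of_crd₁ (f : V ⟶ U) {β β' : (points (Xn a b c (n + 1))).obj (op U)}
    (h : ptHom β ≫ towerSnd a b c n = ptHom β' ≫ towerSnd a b c n)
    (h0 : crd₁ (ptHom β ≫ towerFst a b c n) 0 = crd₁ (ptHom β' ≫ towerFst a b c n) 0)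
    (h2 : crd₁ (ptHom β ≫ towerFst a b c n) 2 ^ 2 = crd₁ (ptHom β' ≫ towerFst a b c n) 2 ^ 2)
    (hu : IsUnit (f.left.appTop (crd₁ (ptHom β ≫ towerFst a b c n) 2 +
      crd₁ (ptHom β' ≫ towerFst a b c n) 2))) :
    (points (Xn a b c (n + 1))).map f.op β = (points (Xn a b c (n + 1))).map f.op β' := by
  refine pt_ext (tower_ext ?_ ?_ ?_)
  · rw [ptHom_map, ptHom_map, Category.assoc, Category.assoc, h]
  · rw [ptHom_map, ptHom_map, Category.assoc, Category.assoc,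
      crd₁_comp _ (ptHom β ≫ towerFst a b c n), crd₁_comp _ (ptHom β' ≫ towerFst a b c n), h0]
  · rw [ptHom_map, ptHom_map, Category.assoc, Category.assoc,
      crd₁_comp _ (ptHom β ≫ towerFst a b c n), crd₁_comp _ (ptHom β' ≫ towerFst a b c n)]
    exact map_eq_map_of_sq_eq f.left.appTop.hom h2 hu

/-- Good lifts agree on the open sets where `x` is invertible, by homotopy, and where `y + y'` is
invertible, on the nose; these cover, because `y = y' = t₀` at the zeros of `x`. -/
lemma IsGoodLift.unique {t₀ : ℂ} (h0 : t₀ ^ 2 = (0 - a) * (0 - b) * (0 - c)) (ht : t₀ ≠ 0)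
    {α : (points (Xn a b c n)).obj (op U)} {τ τ' : (naive (points (Xn a b c (n + 1)))).obj (op U)}
    (h : IsGoodLift t₀ U α τ) (h' : IsGoodLift t₀ U α τ') : τ = τ' := by
  obtain ⟨β, hβ, rfl, h⟩ := h
  obtain ⟨β', hβ', rfl, h'⟩ := h'
  by_cases hx : IsUnit (towerCrd (ptHom α))
  · exact toNaive_eq_of_isUnit (hβ.trans hβ'.symm) (hβ ▸ hx)
  obtain ⟨h1, h2⟩ := h.resolve_left hx
  obtain ⟨h1', h2'⟩ := h'.resolve_left hx
  set x := towerCrd (ptHom α) with hxdef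
  set y := crd₁ (ptHom β ≫ towerFst a b c n) 2 with hydef
  set y' := crd₁ (ptHom β' ≫ towerFst a b c n) 2 with hydef'
  let κ : ℂ →+* Γ(U.left, ⊤) := pull (T := U.left) U.hom
  have hy : y ^ 2 = (x - κ a) * (x - κ b) * (x - κ c) := by
    have := crd₁_towerFst_sq (ptHom β)
    rw [h1, hβ, ptHom_comp_towerStr] at this
    rw [this, one_pow, one_mul]
  have hy' : y' ^ 2 = (x - κ a) * (x - κ b) * (x - κ c) := by
    have := crd₁_towerFst_sq (ptHom β')
    rw [h1', hβ', ptHom_comp_towerStr] at this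
    rw [this, one_pow, one_mul]
  have hG := (isSheaf_iff_isSheaf_of_type _ _).1 (isSheaf_naive (points (Xn a b c (n + 1))))
  let S : Sieve U :=
    { arrows := fun V f => (naive _).map f.op ((toNaive (points (Xn a b c (n + 1)))).app (op U) β) =
        (naive _).map f.op ((toNaive (points (Xn a b c (n + 1)))).app (op U) β')
      downward_closed := by
        intro V W f hf g
        rw [op_comp, Functor.map_comp_apply, Functor.map_comp_apply, hf] }
  have hS : IsNisnevichCovering S := by
    refine isNisnevichCovering_of_opens fun u => ?_
    by_cases hu : u ∈ U.left.basicOpen x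
    · refine ⟨_, hu, ?_⟩
      change (naive _).map _ _ = (naive _).map _ _
      refine (NatTrans.naturality_apply (toNaive _) _ β).symm.trans
        (Eq.trans ?_ (NatTrans.naturality_apply (toNaive _) _ β'))
      refine toNaive_eq_of_isUnit ?_ ?_
      · rw [ptHom_map, ptHom_map, Category.assoc, Category.assoc, hβ, hβ']
      · rw [ptHom_map, Category.assoc, hβ, towerCrd_comp]
        exact isUnit_appTop_openSubι x
    · refine ⟨U.left.basicOpen (y + y'), ?_, ?_⟩
      · let ρ := (U.left.evaluation ⊤ u trivial).hom
        have hρ (v : Γ(U.left, ⊤)) : u ∈ U.left.basicOpen v ↔ ρ v ≠ 0 := mem_basicOpen_iff v u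
        rw [hρ, not_not] at hu
        have hval (z : Γ(U.left, ⊤)) (hz : z ^ 2 = (x - κ a) * (x - κ b) * (x - κ c))
            (hz' : IsUnit (z + κ t₀)) : ρ z = ρ (κ t₀) := by
          have e1 : (ρ z - ρ (κ t₀)) * (ρ z + ρ (κ t₀)) = 0 := by
            have e2 : ρ z ^ 2 = ρ (κ t₀) ^ 2 := by
              rw [← map_pow, hz, ← map_pow, ← map_pow, h0]
              simp only [map_mul, map_sub, hu, map_zero]
            linear_combination e2
          refine sub_eq_zero.1 ((mul_eq_zero.1 e1).resolve_right ?_)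
          rw [← map_add]
          exact (hz'.map ρ).ne_zero
        rw [hρ, map_add, hval y hy h2, hval y' hy' h2', ← map_add, ← map_add]
        have : t₀ + t₀ ≠ 0 := by
          rw [← two_mul]
          exact mul_ne_zero two_ne_zero ht
        exact (map_ne_zero (ρ.comp κ)).2 this
      · change (naive _).map _ _ = (naive _).map _ _
        refine (NatTrans.naturality_apply (toNaive _) _ β).symm.trans
          (Eq.trans ?_ (NatTrans.naturality_apply (toNaive _) _ β'))
        exact congrArg _ (map_eq_map_of_crd₁ _ (hβ.trans hβ'.symm) (h1.trans h1'.symm)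
          (hy.trans hy'.symm) (isUnit_appTop_openSubι (y + y')))
  exact (hG S hS).isSeparatedFor.ext fun V f hf => hf

/-- A function vanishing at `u` pulls back to zero on the spectrum of the residue field of `u`. -/
lemma fromSpecResidueField_appTop_eq_zero {T : Scheme.{0}} {u : T} {v : Γ(T, ⊤)}
    (h : u ∉ T.basicOpen v) : (T.fromSpecResidueField u).appTop v = 0 := by
  by_contra hv
  let o : ↥(Spec (CommRingCat.of (T.residueField u))) := IsLocalRing.closedPoint (T.residueField u)
  refine h ?_
  have h1 : T.fromSpecResidueField u o = u := Scheme.fromSpecResidueField_apply u o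
  rw [← h1, ← mem_basicOpen_appTop]
  refine isUnit_iff_forall_mem_basicOpen.1 ?_ o
  let i := Scheme.ΓSpecIso (.of (T.residueField u))
  have h2 : i.hom ((T.fromSpecResidueField u).appTop v) ≠ 0 := fun h0 => hv (by
    have := congr(i.inv $h0)
    rw [map_zero] at this
    exact (CommRingCat.inv_hom_apply i _).symm.trans this)
  have h3 := (IsUnit.mk0 (G₀ := T.residueField u) _ h2).map i.inv.hom
  exact (CommRingCat.inv_hom_apply i ((T.fromSpecResidueField u).appTop v)) ▸ h3

/-- Good lifts exist on the open set where `x` is invertible, and on the étale neighbourhood of the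
zeros of `x` obtained from `exists_etale_sqrt` by base change along `x`. -/
lemma IsGoodLift.exists_locally {t₀ : ℂ} (h0 : t₀ ^ 2 = (0 - a) * (0 - b) * (0 - c)) (ht : t₀ ≠ 0)
    (α : (points (Xn a b c n)).obj (op U)) : ∃ S : Sieve U, IsNisnevichCovering S ∧
      ∀ ⦃V : Sm ℂ⦄ (f : V ⟶ U), S f → ∃ τ, IsGoodLift t₀ V ((points _).map f.op α) τ := by
  refine ⟨{ arrows := fun V f => ∃ τ, IsGoodLift t₀ V ((points _).map f.op α) τ
            downward_closed := ?_ }, ?_, fun V f hf => hf⟩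
  · rintro V W f ⟨τ, hτ⟩ g
    refine ⟨(naive _).map g.op τ, ?_⟩
    rw [op_comp, Functor.map_comp_apply]
    exact hτ.map g
  intro u
  by_cases hu : u ∈ U.left.basicOpen (towerCrd (ptHom α))
  · let f := openSubι U (U.left.basicOpen (towerCrd (ptHom α)))
    have hunit : IsUnit (towerCrd (ptHom ((points _).map f.op α))) := by
      rw [ptHom_map, towerCrd_comp]
      exact isUnit_appTop_openSubι _
    refine ⟨_, f, ?_, inferInstanceAs (Etale (Scheme.Opens.ι _)), ⟨u, hu⟩, rfl,
      bijective_residueFieldMap_openSubι U _ _⟩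
    obtain ⟨β, hβ, -, -⟩ := exists_lift_tower (ptHom ((points _).map f.op α)) 0 0 (by ring)
      (fun t => .inr (isUnit_iff_forall_mem_basicOpen.1 hunit t))
    obtain ⟨γ, hγ⟩ := exists_ptHom_eq (f := β)
      (by rw [← towerSnd_towerStr, ← Category.assoc, hβ, ptHom_comp_towerStr])
    exact ⟨_, γ, by rw [hγ, hβ], rfl, .inl hunit⟩
  · obtain ⟨E, e, v, t, _, _, ⟨o, hv⟩, hb, ht2, htu⟩ := exists_etale_sqrt h0 ht
    let g : U.left ⟶ A1 (Spec (.of ℂ)) := ptHom α ≫ (tower a b c n).hom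
    have hg : g ≫ A1str = U.hom := by
      rw [Category.assoc]
      exact ptHom_comp_towerStr α
    -- As `x` vanishes at `u`, the residue field of `u` maps to the origin of `𝔸¹`.
    have hgu : e v = g u := by
      have h1 : U.left.fromSpecResidueField u ≫ g =
          (U.left.fromSpecResidueField u ≫ U.hom) ≫ sec (Spec (.of ℂ)) 0 := by
        refine A1_hom_ext ?_ ?_
        · rw [Category.assoc, hg, Category.assoc, AffineSpace.homOfVector_over]
          exact (Category.comp_id _).symm
        · rw [crd_comp _ g, crd_comp _ (sec _ 0), crd_homOfVector, map_zero]
          exact fromSpecResidueField_appTop_eq_zero hu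
      let o' : ↥(Spec (CommRingCat.of (U.left.residueField u))) :=
        IsLocalRing.closedPoint (U.left.residueField u)
      have h2 : U.left.fromSpecResidueField u o' = u := Scheme.fromSpecResidueField_apply u o'
      have h3 : (U.left.fromSpecResidueField u ≫ g) o' =
          ((U.left.fromSpecResidueField u ≫ U.hom) ≫ sec (Spec (.of ℂ)) 0) o' := by rw [h1]
      rw [Scheme.Hom.comp_apply _ g, h2] at h3
      rw [hv, h3]
      exact congrArg (sec (Spec (.of ℂ)) 0) (Subsingleton.elim (α := PrimeSpectrum ℂ) _ _)
    obtain ⟨p, hp, hpb⟩ := exists_lift_residue e g v u hgu hb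
    have : Smooth U.hom := U.prop.1
    have : QuasiCompact U.hom := U.prop.2
    let P : Sm ℂ := MorphismProperty.Over.mk ⊤ (pullback.snd e g ≫ U.hom)
      ⟨inferInstance, inferInstance⟩
    let q : P ⟶ U := MorphismProperty.Over.homMk (pullback.snd e g) rfl trivial
    let r : P.left ⟶ E := pullback.fst e g
    have hrq : r ≫ e = q.left ≫ g := pullback.condition
    have hP (z : ℂ) : pull (T := P.left) P.hom z = r.appTop (pull (e ≫ A1str) z) := by
      rw [← pull_comp, ← Category.assoc, hrq, Category.assoc, hg]
      rfl
    refine ⟨P, q, ?_, (inferInstance : Etale (pullback.snd e g)), p, hp, hpb⟩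
    obtain ⟨β, hβ, hβ0, hβ2⟩ := exists_lift_tower (ptHom ((points _).map q.op α)) 1 (r.appTop t) (by
        have hx : towerCrd (ptHom ((points _).map q.op α)) = r.appTop (crd e) := by
          rw [← crd_comp, hrq, ptHom_map, towerCrd, Category.assoc]
        rw [ptHom_comp_towerStr, hx, hP, hP, hP, ← map_pow, ht2]
        simp only [map_mul, map_sub, one_pow, one_mul])
      (fun t => .inl (isUnit_iff_forall_mem_basicOpen.1 isUnit_one t))
    obtain ⟨γ, hγ⟩ := exists_ptHom_eq (f := β)
      (by rw [← towerSnd_towerStr, ← Category.assoc, hβ, ptHom_comp_towerStr])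
    refine ⟨_, γ, by rw [hγ, hβ], rfl, .inr ⟨by rw [hγ, hβ0], ?_⟩⟩
    rw [hγ, hβ2, hP, ← map_add]
    exact htu.map _

/-- `Xₙ` is a retract of `𝒮(Xₙ₊₁)`. -/
lemma nonempty_retract_naive (ha : a ≠ 0) (hb : b ≠ 0) (hc : c ≠ 0) (hab : a ≠ b) (hac : a ≠ c)
    (hbc : b ≠ c) (n : ℕ) :
    Nonempty (Retract (points (Xn a b c n)) (naive (points (Xn a b c (n + 1))))) := by
  obtain ⟨t₀, h0⟩ := IsAlgClosed.exists_pow_nat_eq ((0 - a) * (0 - b) * (0 - c)) two_pos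
  have ht : t₀ ≠ 0 := by
    rintro rfl
    simp [ha, hb, hc] at h0
  obtain ⟨s, hs⟩ := exists_hom_of_locally (isSheaf_naive (points (Xn a b c (n + 1))))
    (IsGoodLift t₀ (a := a) (b := b) (c := c) (n := n)) (fun f _ _ h => h.map f)
    (fun h h' => h.unique h0 ht h') (fun α => IsGoodLift.exists_locally h0 ht α)
  refine ⟨⟨s, naiveDropFirst hab hac hbc n, ?_⟩⟩
  ext U α
  obtain ⟨S, hS, h⟩ := IsGoodLift.exists_locally (U := U.unop) h0 ht α
  have hG := (isSheaf_iff_isSheaf_of_type _ _).1 (isSheaf_points (Xn a b c n))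
  refine (hG S hS).isSeparatedFor.ext fun V f hf => ?_
  obtain ⟨τ, hτ⟩ := h f hf
  have h1 := NatTrans.naturality_apply (s ≫ naiveDropFirst hab hac hbc n) f.op α
  refine h1.symm.trans ?_
  change (naiveDropFirst hab hac hbc n).app _ (s.app _ _) = _
  refine (congrArg _ (hs hτ)).trans ?_
  obtain ⟨β, hβ, rfl, -⟩ := hτ
  have h2 := congr($(toNaive_naiveDesc (isSheaf_points _) (pointsMap (dropFirst a b c n))
    (pointsMap_dropFirst_homotopy hab hac hbc n)).app (op V) β)
  exact h2.trans (pt_ext ((ptHom_dropFirst β).trans hβ))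

/-- The points `0` and `1` of `X₀ = 𝔸¹` are homotopic. -/
lemma exists_homotopic_points : ∃ x y : (points (Xn a b c 0)).obj (op (pt ℂ)), x ≠ y ∧
    A1Homotopic (points (Xn a b c 0)) (pt ℂ) x y := by
  let h : (points (Xn a b c 0)).obj (op (cyl.obj (pt ℂ))) :=
    ⟨Over.homMk (𝟙 (A1 (Spec (.of ℂ)))) (by
      change 𝟙 _ ≫ 𝟙 _ ≫ A1str = A1str ≫ 𝟙 _
      simp)⟩
  refine ⟨_, _, fun he => ?_, h, rfl, rfl⟩
  have h1 : ptHom ((points (Xn a b c 0)).map (sect (pt ℂ) 0).op h) = sec (Spec (.of ℂ)) 0 :=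
    Category.comp_id _
  have h2 : ptHom ((points (Xn a b c 0)).map (sect (pt ℂ) 1).op h) = sec (Spec (.of ℂ)) 1 :=
    Category.comp_id _
  have h3 : sec (Spec (.of ℂ)) 0 = sec (Spec (.of ℂ)) 1 := h1.symm.trans ((congrArg ptHom he).trans h2)
  have h4 := congr(crd $h3)
  rw [crd_homOfVector, crd_homOfVector, ← map_zero cst, ← map_one cst] at h4
  exact zero_ne_one (cst_injective h4)

lemma not_injective_naiveIterSucc (ha : a ≠ 0) (hb : b ≠ 0) (hc : c ≠ 0) (hab : a ≠ b)
    (hac : a ≠ c) (hbc : b ≠ c) (n : ℕ) :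
    ¬ Function.Injective ((naiveIterSucc (points (Xn a b c n)) n).app (op (pt ℂ))) := by
  obtain ⟨r⟩ := nonempty_retract_naiveIter (F := fun n => points (Xn a b c n))
    (nonempty_retract_naive ha hb hc hab hac hbc) n
  obtain ⟨x, y, hxy, h⟩ := exists_homotopic_points (a := a) (b := b) (c := c)
  exact not_injective_toNaive r hxy h

end

/-! ### The affine models of the fibre products -/

section

open Polynomial

variable {D : Type} [CommRing D]

/-- An element of a domain that is not a square in the fraction field: `g q² = p²` only if
`q = 0`. -/
def IsNonsquare (g : D) : Prop := ∀ p q : D, p ^ 2 = g * q ^ 2 → q = 0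

/-- `D[X][Y] / (Y² - X² g)`. -/
abbrev CoverRing (g : D) : Type := QuadraticAlgebra D[X] (X ^ 2 * C g) 0

variable [IsDomain D] {g : D}

lemma IsNonsquare.ne_zero (hg : IsNonsquare g) : g ≠ 0 := by
  rintro rfl
  exact one_ne_zero (hg 0 1 (by simp))

lemma IsNonsquare.eq_zero_of_sq_eq (hg : IsNonsquare g) {p q : D[X]} (h : p ^ 2 = C g * q ^ 2) :
    q = 0 := by
  have := congr(leadingCoeff $h)
  rw [leadingCoeff_pow, leadingCoeff_mul, leadingCoeff_C, leadingCoeff_pow] at this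
  exact leadingCoeff_eq_zero.1 (hg _ _ this)

lemma IsNonsquare.eq_zero_of_norm (hg : IsNonsquare g) {z : CoverRing g}
    (h : QuadraticAlgebra.norm z = 0) : z = 0 := by
  rw [QuadraticAlgebra.norm_def] at h
  have h1 : z.re ^ 2 = C g * (X * z.im) ^ 2 := by linear_combination h
  have h2 : z.im = 0 := by simpa using hg.eq_zero_of_sq_eq h1
  have h3 : z.re = 0 := by simpa [h2] using h1
  ext1
  · exact h3
  · exact h2

lemma IsNonsquare.isDomain (hg : IsNonsquare g) : IsDomain (CoverRing g) := by
  have : NoZeroDivisors (CoverRing g) := ⟨fun {z w} h => by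
    have := congr(QuadraticAlgebra.norm $h)
    rw [map_mul, QuadraticAlgebra.norm_zero, mul_eq_zero] at this
    exact this.imp hg.eq_zero_of_norm hg.eq_zero_of_norm⟩
  exact NoZeroDivisors.to_isDomain _

/-- The norm form shows that a polynomial of odd degree does not become a square in the fraction
field of `D[X][Y] / (Y² - X² g)`. -/
lemma IsNonsquare.of_odd_natDegree (hg : IsNonsquare g) (h2 : (2 : D) ≠ 0) {φ : D[X]}
    (hφ : Odd φ.natDegree) : IsNonsquare (algebraMap D[X] (CoverRing g) φ) := by
  have hφ0 : φ ≠ 0 := by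
    rintro rfl
    simp at hφ
  intro P Q h
  refine hg.eq_zero_of_norm ?_
  set N := QuadraticAlgebra.norm Q with hN
  set S := P * star Q with hS
  have h1 : S * S = algebraMap D[X] (CoverRing g) (φ * (N * N)) := by
    rw [map_mul, map_mul, hN, QuadraticAlgebra.algebraMap_norm_eq_mul_star, hS]
    linear_combination (star Q) ^ 2 * h
  have hre : S.re ^ 2 + X ^ 2 * C g * S.im ^ 2 = φ * N ^ 2 := by
    have := congr(QuadraticAlgebra.re $h1)
    rw [QuadraticAlgebra.re_mul, QuadraticAlgebra.algebraMap_re] at this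
    linear_combination this
  have him : S.re = 0 ∨ S.im = 0 := by
    have := congr(QuadraticAlgebra.im $h1)
    rw [QuadraticAlgebra.im_mul, QuadraticAlgebra.algebraMap_im] at this
    have h3 : C (2 : D) * (S.re * S.im) = 0 := by
      rw [map_ofNat]
      linear_combination this
    rw [mul_eq_zero, C_eq_zero, mul_eq_zero] at h3
    exact h3.resolve_left h2
  by_contra hN0
  have hdeg : (φ * N ^ 2).natDegree = φ.natDegree + 2 * N.natDegree := by
    rw [natDegree_mul hφ0 (pow_ne_zero _ hN0), natDegree_pow]
  obtain ⟨k, hk⟩ := hφ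
  rcases him with h0 | h0
  · have h4 : (X * S.im) ^ 2 * C g = φ * N ^ 2 := by
      rw [← hre, h0]
      ring
    have h5 := congr(natDegree $h4)
    rw [natDegree_mul_C hg.ne_zero, natDegree_pow, hdeg] at h5
    omega
  · have h4 : S.re ^ 2 = φ * N ^ 2 := by
      rw [← hre, h0]
      ring
    have h5 := congr(natDegree $h4)
    rw [natDegree_pow, hdeg] at h5
    omega

end

section

open Polynomial

variable {D : Type} [CommRing D]

/-- Adjoining a variable and the square root of an element raises the dimension by at most one. -/
lemma ringKrullDim_coverRing_le [IsNoetherianRing D] (g : D) :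
    ringKrullDim (CoverRing g) ≤ ringKrullDim D + 1 := by
  rw [← Polynomial.ringKrullDim_of_isNoetherianRing]
  refine Order.krullDim_le_of_strictMono (PrimeSpectrum.comap (algebraMap D[X] (CoverRing g))) ?_
  intro P Q h
  exact Ideal.IsIntegral.comap_lt_comap h

/-- A maximal ideal `m` of `D` is dominated by a maximal ideal of `D[X][Y] / (Y² - X² g)` that
contains `X - 1`, and the latter has larger height. -/
lemma exists_isMaximal_coverRing [IsNoetherianRing D] (g : D) (m : Ideal D) [m.IsMaximal] :
    ∃ M : Ideal (CoverRing g), M.IsMaximal ∧ M.comap (algebraMap D (CoverRing g)) = m ∧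
      algebraMap D[X] (CoverRing g) X - 1 ∈ M ∧ m.height + 1 ≤ M.height := by
  let P : Ideal D[X] := m.comap (evalRingHom 1)
  have hsurj : Function.Surjective (evalRingHom (1 : D)) := fun d => ⟨C d, by simp⟩
  have hP : P.IsMaximal := Ideal.comap_isMaximal_of_surjective _ hsurj
  have hPm : P.LiesOver m := ⟨by
    ext d
    simp [P, Ideal.under, Ideal.mem_comap]⟩
  obtain ⟨M, hM, hMP⟩ := Ideal.exists_ideal_over_maximal_of_isIntegral (S := CoverRing g) P (by
    have h : Function.Injective (algebraMap D[X] (CoverRing g)) :=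
      QuadraticAlgebra.algebraMap_injective
    rw [(RingHom.injective_iff_ker_eq_bot _).1 h]
    exact bot_le)
  have : M.LiesOver P := ⟨hMP.symm⟩
  refine ⟨M, hM, ?_, ?_, ?_⟩
  · have h1 : algebraMap D (CoverRing g) = (algebraMap D[X] (CoverRing g)).comp C := rfl
    rw [h1, ← Ideal.comap_comap, hMP]
    exact hPm.over.symm
  · have h1 : (X - 1 : D[X]) ∈ P := by
      simp [P, Ideal.mem_comap]
    rw [← hMP, Ideal.mem_comap, map_sub, map_one] at h1
    exact h1
  · have : IsNoetherianRing (CoverRing g) := IsNoetherianRing.of_finite D[X] _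
    rw [← Polynomial.height_eq_height_add_one m P,
      Ideal.height_eq_height_add_of_liesOver_of_hasGoingDown P M]
    exact le_self_add

end

/-! ### `Xₙ` as an open subscheme of an integral affine scheme -/

section

open Polynomial

variable {D : Type} [CommRing D] {g : D} {T : Scheme.{0}}

lemma coverRing_hom_ext {F G : T ⟶ Spec (.of (CoverRing g))}
    (hC : ∀ d : D, pull F (algebraMap D (CoverRing g) d) = pull G (algebraMap D (CoverRing g) d))
    (hX : pull F (algebraMap D[X] (CoverRing g) X) = pull G (algebraMap D[X] (CoverRing g) X))
    (hω : pull F (QuadraticAlgebra.omega : CoverRing g) =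
      pull G (QuadraticAlgebra.omega : CoverRing g)) : F = G := by
  have h : (pull F).comp (algebraMap D[X] (CoverRing g)) =
      (pull G).comp (algebraMap D[X] (CoverRing g)) := Polynomial.ringHom_ext hC hX
  refine pull_injective (RingHom.ext fun z => ?_)
  obtain ⟨u, v⟩ := z
  have h1 : (⟨u, v⟩ : CoverRing g) = algebraMap D[X] (CoverRing g) u +
      algebraMap D[X] (CoverRing g) v * QuadraticAlgebra.omega := by
    rw [QuadraticAlgebra.mk_eq_add_smul_omega, Algebra.smul_def]
  rw [h1, map_add, map_add, map_mul, map_mul, hω]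
  exact congr($h u + $h v * _)

lemma omega_sq (g : D) : (QuadraticAlgebra.omega : CoverRing g) ^ 2 =
    algebraMap D[X] (CoverRing g) X ^ 2 * algebraMap D (CoverRing g) g := by
  have h : algebraMap D (CoverRing g) g = algebraMap D[X] (CoverRing g) (C g) := rfl
  rw [h, ← map_pow, ← map_mul]
  refine (pow_two _).trans ?_
  exact QuadraticAlgebra.omega_mul_omega_eq_mk (R := D[X])

/-- Morphisms to the spectrum of `D[X][Y] / (Y² - X² g)` in coordinates. -/
lemma exists_coverRing_hom (f : T ⟶ Spec (.of D)) (x₀ y : Γ(T, ⊤)) (h : y ^ 2 = x₀ ^ 2 * pull f g) :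
    ∃ F : T ⟶ Spec (.of (CoverRing g)), (∀ d, pull F (algebraMap D (CoverRing g) d) = pull f d) ∧
      pull F (algebraMap D[X] (CoverRing g) X) = x₀ ∧
      pull F (QuadraticAlgebra.omega : CoverRing g) = y := by
  let e : D[X] →+* Γ(T, ⊤) := eval₂RingHom (pull f) x₀
  let : Algebra D[X] Γ(T, ⊤) := e.toAlgebra
  have he (p : D[X]) : algebraMap D[X] Γ(T, ⊤) p = e p := rfl
  let φ : CoverRing g →ₐ[D[X]] Γ(T, ⊤) := QuadraticAlgebra.lift ⟨y, by
    rw [zero_smul, add_zero, Algebra.smul_def, mul_one, he, ← pow_two, h]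
    simp only [e, coe_eval₂RingHom, eval₂_mul, eval₂_X_pow, eval₂_C]⟩
  refine ⟨toSpec (R := .of (CoverRing g)) φ.toRingHom, fun d => ?_, ?_, ?_⟩
  · rw [pull_toSpec]
    refine (φ.commutes (C d)).trans ?_
    rw [he]
    simp [e]
  · rw [pull_toSpec]
    refine (φ.commutes X).trans ?_
    rw [he]
    simp [e]
  · rw [pull_toSpec]
    refine (QuadraticAlgebra.lift_apply_apply _ _).trans ?_
    simp

end

section

open Polynomial

variable {D : Type} [CommRing D] [Algebra ℂ D] {a b c : ℂ}

variable (a b c) in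
/-- `f(x) = (x - a)(x - b)(x - c)` in a `ℂ`-algebra. -/
abbrev cubic (x : D) : D :=
  (x - algebraMap ℂ D a) * (x - algebraMap ℂ D b) * (x - algebraMap ℂ D c)

lemma natDegree_cubic [IsDomain D] : (cubic a b c (X : D[X])).natDegree = 3 := by
  have h (z : ℂ) : algebraMap ℂ D[X] z = C (algebraMap ℂ D z) := rfl
  rw [cubic, h, h, h, natDegree_mul (mul_ne_zero (X_sub_C_ne_zero _) (X_sub_C_ne_zero _))
    (X_sub_C_ne_zero _), natDegree_mul (X_sub_C_ne_zero _) (X_sub_C_ne_zero _), natDegree_X_sub_C,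
    natDegree_X_sub_C, natDegree_X_sub_C]

variable (a b c) in
/-- Data exhibiting `Xₙ` as an open subscheme of the spectrum of a domain `D` of dimension at most
`n + 1`, in which the cubic polynomial at the first coordinate `x` is not a square, together with a
point of `Xₙ` at which `x = 1` and whose local ring has dimension at least `n + 1`. -/
structure TowerModel (n : ℕ) where
  /-- the coordinate ring -/
  D : Type
  [commRing : CommRing D]
  [isDomain : IsDomain D]
  [isNoetherianRing : IsNoetherianRing D]
  [algebra : Algebra ℂ D]
  /-- the first coordinate -/
  x : D
  isNonsquare : IsNonsquare (cubic a b c x)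
  /-- the open immersion -/
  j : (tower a b c n).left ⟶ Spec (.of D)
  [isOpenImmersion : IsOpenImmersion j]
  pull_x : pull j x = crd (tower a b c n).hom
  pull_algebraMap : ∀ z : ℂ, pull j (algebraMap ℂ D z) = pull (towerStr a b c n) z
  dim_le : ringKrullDim D ≤ n + 1
  /-- the closed point -/
  pt : (tower a b c n).left
  isMaximal : (j pt).asIdeal.IsMaximal
  x_sub_one_mem : x - 1 ∈ (j pt).asIdeal
  le_height : n + 1 ≤ (j pt).asIdeal.height

attribute [instance] TowerModel.commRing TowerModel.isDomain TowerModel.isNoetherianRing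
  TowerModel.algebra TowerModel.isOpenImmersion

/-- For `n = 0` the model is `𝔸¹ ≅ Spec ℂ[X]` with the point `X = 1`. -/
lemma nonempty_towerModel_zero : Nonempty (TowerModel a b c 0) := by
  let j : A1 (Spec (.of ℂ)) ⟶ Spec (.of ℂ[X]) := toSpec (R := .of ℂ[X]) polyFun
  have : IsIso (CommRingCat.ofHom polyFun) :=
    (ConcreteCategory.isIso_iff_bijective _).2 ⟨polyFun_injective, polyFun_surjective⟩
  have : IsIso j := by
    dsimp only [j, toSpec]
    infer_instance
  have hj : pull j = polyFun := pull_toSpec _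
  let P : Ideal ℂ[X] := (⊥ : Ideal ℂ).comap (evalRingHom 1)
  have hsurj : Function.Surjective (evalRingHom (1 : ℂ)) := fun d => ⟨C d, by simp⟩
  have hP : P.IsMaximal := Ideal.comap_isMaximal_of_surjective _ hsurj
  have hPm : P.LiesOver (⊥ : Ideal ℂ) := ⟨by
    ext d
    simp [P, Ideal.under, Ideal.mem_comap]⟩
  let s : Spec (.of ℂ[X]) := (⟨P, hP.isPrime⟩ : PrimeSpectrum ℂ[X])
  obtain ⟨t, ht⟩ : ∃ t, j t = s := ⟨inv j s, by
    rw [← Scheme.Hom.comp_apply, IsIso.inv_hom_id]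
    rfl⟩
  have hs : s.asIdeal = P := rfl
  have h : IsNonsquare (cubic a b c (X : ℂ[X])) := by
    intro p q h
    by_contra hq
    have h3 : (cubic a b c (X : ℂ[X])).natDegree = 3 := natDegree_cubic
    have h0 : cubic a b c (X : ℂ[X]) ≠ 0 := by
      intro h0
      rw [h0, natDegree_zero] at h3
      omega
    have := congr(natDegree $h)
    rw [natDegree_pow, natDegree_mul h0 (pow_ne_zero _ hq), h3, natDegree_pow] at this
    omega
  have hi : IsOpenImmersion j := inferInstance
  refine ⟨{ D := ℂ[X], x := X, isNonsquare := h, j := j, isOpenImmersion := hi, pull_x := ?_,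
            pull_algebraMap := ?_, dim_le := ?_, pt := t, isMaximal := ?_, x_sub_one_mem := ?_,
            le_height := ?_ }⟩
  · refine congr($hj X).trans ?_
    have h1 : crd (tower a b c 0).hom = AffineSpace.coord _ PUnit.unit := by
      change (Scheme.Hom.appTop (𝟙 (A1 (Spec (.of ℂ))))) _ = _
      simp
    rw [h1]
    simp [polyFun]
  · intro z
    refine congr($hj (C z)).trans ((polyFun_C z).trans ?_)
    exact congr(pull $((Category.id_comp A1str).symm) z)
  · simp
  · exact (congrArg (fun u : PrimeSpectrum ℂ[X] => u.asIdeal.IsMaximal) ht).mpr hP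
  · refine (congrArg (fun u : PrimeSpectrum ℂ[X] => X - 1 ∈ u.asIdeal) ht).mpr ?_
    simp [hs, P, Ideal.mem_comap]
  · refine (congrArg (fun u : PrimeSpectrum ℂ[X] => _ ≤ u.asIdeal.height) ht).mpr ?_
    rw [hs, Polynomial.height_eq_height_add_one (⊥ : Ideal ℂ) P]
    simp

end

section

open Polynomial

variable {a b c : ℂ} {n : ℕ} (M : TowerModel a b c n)

namespace TowerModel

/-- The coordinate ring of the next affine model. -/
abbrev Next : Type := CoverRing (cubic a b c M.x)

/-- The new first coordinate. -/
def nextX : M.Next := algebraMap M.D[X] M.Next X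

/-- The projection to the previous affine model. -/
def nextProj : Spec (.of M.Next) ⟶ Spec (.of M.D) :=
  Spec.map (CommRingCat.ofHom (algebraMap M.D M.Next))

lemma pull_comp_nextProj {T : Scheme.{0}} (F : T ⟶ Spec (.of M.Next)) (d : M.D) :
    pull (F ≫ M.nextProj) d = pull F (algebraMap M.D M.Next d) := pull_comp_SpecMap _ _ _

lemma pull_comp_j {T : Scheme.{0}} (α : T ⟶ (tower a b c n).left) :
    pull (α ≫ M.j) M.x = towerCrd α := by
  rw [pull_comp, M.pull_x, towerCrd, crd_comp]

lemma pull_comp_j_cubic {T : Scheme.{0}} (α : T ⟶ (tower a b c n).left) :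
    pull (α ≫ M.j) (cubic a b c M.x) = (towerCrd α - pull (α ≫ towerStr a b c n) a) *
      (towerCrd α - pull (α ≫ towerStr a b c n) b) *
      (towerCrd α - pull (α ≫ towerStr a b c n) c) := by
  have h (z : ℂ) : pull (α ≫ M.j) (algebraMap ℂ M.D z) = pull (α ≫ towerStr a b c n) z := by
    rw [pull_comp, M.pull_algebraMap]
    exact (pull_comp α (towerStr a b c n) z).symm
  rw [cubic, map_mul, map_mul, map_sub, map_sub, map_sub, M.pull_comp_j, h, h, h]

/-- The coordinates define a morphism from `Xₙ₊₁` to the next affine model. -/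
lemma exists_nextJ : ∃ F : (tower a b c (n + 1)).left ⟶ Spec (.of M.Next),
    F ≫ M.nextProj = towerSnd a b c n ≫ M.j ∧
      pull F M.nextX = crd₁ (towerFst a b c n) 0 ∧
      pull F (QuadraticAlgebra.omega : M.Next) = crd₁ (towerFst a b c n) 2 := by
  obtain ⟨F, hF, hX, hω⟩ := exists_coverRing_hom (g := cubic a b c M.x) (towerSnd a b c n ≫ M.j)
    (crd₁ (towerFst a b c n) 0) (crd₁ (towerFst a b c n) 2) (by
      rw [M.pull_comp_j_cubic]
      have := crd₁_towerFst_sq (𝟙 (tower a b c (n + 1)).left)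
      rw [Category.id_comp, Category.id_comp, Category.id_comp, ← towerSnd_towerStr] at this
      exact this)
  refine ⟨F, pull_injective (RingHom.ext fun d => ?_), hX, hω⟩
  rw [pull_comp_nextProj, hF]

/-- The open subscheme of the next affine model that is isomorphic to `Xₙ₊₁`. -/
def nextOpen : (Spec (.of M.Next)).Opens :=
  M.nextProj ⁻¹ᵁ M.j.opensRange ⊓ ((Spec (.of M.Next)).basicOpen (pull (𝟙 _) M.nextX) ⊔
    (Spec (.of M.Next)).basicOpen (pull (𝟙 _) (algebraMap M.D M.Next M.x)))

/-- The inclusion of `nextOpen` factors through `Xₙ₊₁`. -/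
lemma exists_nextOpen_hom {F : (tower a b c (n + 1)).left ⟶ Spec (.of M.Next)}
    (hF : F ≫ M.nextProj = towerSnd a b c n ≫ M.j)
    (hX : pull F M.nextX = crd₁ (towerFst a b c n) 0)
    (hω : pull F (QuadraticAlgebra.omega : M.Next) = crd₁ (towerFst a b c n) 2) :
    ∃ β : M.nextOpen.toScheme ⟶ (tower a b c (n + 1)).left, β ≫ F = M.nextOpen.ι := by
  let i : M.nextOpen.toScheme ⟶ Spec (.of M.Next) := M.nextOpen.ι
  have hmem (t : M.nextOpen.toScheme) : i t ∈ M.nextOpen := t.2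
  let α : M.nextOpen.toScheme ⟶ (tower a b c n).left :=
    IsOpenImmersion.lift M.j (i ≫ M.nextProj) (by
      rintro _ ⟨t, rfl⟩
      rw [Scheme.Hom.comp_apply]
      exact (hmem t).1)
  have hα : α ≫ M.j = i ≫ M.nextProj := IsOpenImmersion.lift_fac _ _ _
  have hx : towerCrd α = pull i (algebraMap M.D M.Next M.x) := by
    rw [← M.pull_comp_j, hα, pull_comp_nextProj]
  obtain ⟨β, hβ, h0, h2⟩ := exists_lift_tower α (pull i M.nextX)
    (pull i (QuadraticAlgebra.omega : M.Next)) (by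
      rw [← M.pull_comp_j_cubic, hα, pull_comp_nextProj, ← map_pow, ← map_pow, ← map_mul]
      exact congrArg (pull i) (omega_sq (cubic a b c M.x))) (fun t => by
        rw [hx]
        refine (hmem t).2.imp (fun h => ?_) (fun h => ?_)
        · rw [mem_basicOpen_pull]
          exact (mem_basicOpen_pull (𝟙 _) _ _).1 h
        · rw [mem_basicOpen_pull]
          exact (mem_basicOpen_pull (𝟙 _) _ _).1 h)
  refine ⟨β, coverRing_hom_ext (fun d => ?_) ?_ ?_⟩
  · rw [← pull_comp_nextProj, Category.assoc, hF, ← Category.assoc, hβ, hα, pull_comp_nextProj]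
  · exact (pull_comp β F M.nextX).trans 
      ((congrArg β.appTop hX).trans ((crd₁_comp _ _ _).symm.trans h0))
  · rw [pull_comp, hω, ← crd₁_comp, h2]

/-- `Xₙ₊₁` and `nextOpen` have the same coordinates, so the factorizations in both directions are
mutually inverse. -/
lemma isOpenImmersion_nextJ {F : (tower a b c (n + 1)).left ⟶ Spec (.of M.Next)}
    (hF : F ≫ M.nextProj = towerSnd a b c n ≫ M.j)
    (hX : pull F M.nextX = crd₁ (towerFst a b c n) 0)
    (hω : pull F (QuadraticAlgebra.omega : M.Next) = crd₁ (towerFst a b c n) 2) :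
    IsOpenImmersion F := by
  obtain ⟨β, hβ⟩ := M.exists_nextOpen_hom hF hX hω
  have hx : pull F (algebraMap M.D M.Next M.x) = crd₁ (towerFst a b c n) 1 := by
    rw [← pull_comp_nextProj, hF, M.pull_comp_j]
    have := crd₁_towerFst_one (𝟙 (tower a b c (n + 1)).left)
    rw [Category.id_comp, Category.id_comp] at this
    exact this.symm
  let l : (tower a b c (n + 1)).left ⟶ M.nextOpen.toScheme := IsOpenImmersion.lift M.nextOpen.ι F (by
    rintro _ ⟨t, rfl⟩
    rw [Scheme.Opens.range_ι]
    refine ⟨?_, ?_⟩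
    · change M.nextProj (F t) ∈ Set.range M.j
      rw [← Scheme.Hom.comp_apply, hF, Scheme.Hom.comp_apply]
      exact ⟨_, rfl⟩
    · refine (crd₁_ne (towerFst a b c n) t).imp (fun h => ?_) (fun h => ?_)
      · rw [← hX, mem_basicOpen_pull] at h
        exact (mem_basicOpen_pull (𝟙 _) _ _).2 h
      · rw [← hx, mem_basicOpen_pull] at h
        exact (mem_basicOpen_pull (𝟙 _) _ _).2 h)
  have hl : l ≫ M.nextOpen.ι = F := IsOpenImmersion.lift_fac _ _ _
  have hlβ : (l ≫ β) ≫ F = F := by rw [Category.assoc, hβ, hl]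
  have h1 : l ≫ β = 𝟙 _ := by
    refine tower_ext ?_ ?_ ?_
    · rw [← cancel_mono M.j, Category.assoc, ← hF, ← Category.assoc, hlβ, Category.id_comp, hF]
    · rw [crd₁_comp, ← hX, ← pull_comp, hlβ, hX, Category.id_comp]
    · rw [crd₁_comp, ← hω, ← pull_comp, hlβ, hω, Category.id_comp]
  have h2 : β ≫ l = 𝟙 _ := by
    rw [← cancel_mono M.nextOpen.ι, Category.assoc, hl, hβ, Category.id_comp]
  have : IsIso l := ⟨β, h1, h2⟩
  rw [← hl]
  infer_instance

lemma nonempty_succ (M : TowerModel a b c n) : Nonempty (TowerModel a b c (n + 1)) := by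
  obtain ⟨F, hF, hX, hω⟩ := M.exists_nextJ
  have hopen := M.isOpenImmersion_nextJ hF hX hω
  obtain ⟨β, hβ⟩ := M.exists_nextOpen_hom hF hX hω
  have := M.isMaximal
  obtain ⟨m, hm, hmc, hmX, hmh⟩ := exists_isMaximal_coverRing (cubic a b c M.x) (M.j M.pt).asIdeal
  let s : Spec (.of M.Next) := (⟨m, hm.isPrime⟩ : PrimeSpectrum M.Next)
  have hs : s ∈ M.nextOpen := by
    refine ⟨⟨M.pt, ?_⟩, .inl ((mem_basicOpen_pull (𝟙 _) _ _).2 fun (h : M.nextX ∈ m) => ?_)⟩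
    · exact PrimeSpectrum.ext hmc.symm
    · -- `X` and `X - 1` do not both vanish.
      have := m.sub_mem h hmX
      rw [nextX, sub_sub_cancel] at this
      exact hm.ne_top ((Ideal.eq_top_iff_one _).2 this)
  let s' : M.nextOpen.toScheme := ⟨s, hs⟩
  have ht : F (β s') = s := by
    rw [← Scheme.Hom.comp_apply, hβ]
    rfl
  have h2 : (2 : M.D) ≠ 0 := by
    rw [← map_ofNat (algebraMap ℂ M.D) 2]
    exact (map_ne_zero_iff _ (algebraMap ℂ M.D).injective).2 two_ne_zero
  have hcubic : cubic a b c M.nextX = algebraMap M.D[X] M.Next (cubic a b c X) := by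
    simp only [cubic, nextX, map_mul, map_sub]
    rfl
  have hdom : IsDomain M.Next := M.isNonsquare.isDomain
  refine ⟨{ D := M.Next, x := M.nextX, isNoetherianRing := IsNoetherianRing.of_finite M.D[X] _,
            isNonsquare := ?_, j := F, pull_x := ?_, pull_algebraMap := ?_, dim_le := ?_,
            pt := β s', isMaximal := ?_, x_sub_one_mem := ?_, le_height := ?_ }⟩
  · rw [hcubic]
    refine M.isNonsquare.of_odd_natDegree h2 ?_
    rw [natDegree_cubic]
    decide
  · rw [hX, tower_succ_hom, crd_proj₁]
  · intro z
    have h : algebraMap ℂ M.Next z = algebraMap M.D M.Next (algebraMap ℂ M.D z) := rfl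
    rw [h, ← pull_comp_nextProj, hF, pull_comp, M.pull_algebraMap, ← pull_comp, towerSnd_towerStr]
  · refine (ringKrullDim_coverRing_le _).trans ?_
    push_cast
    gcongr
    exact M.dim_le
  · exact (congrArg (fun u : PrimeSpectrum M.Next => u.asIdeal.IsMaximal) ht).mpr hm
  · exact (congrArg (fun u : PrimeSpectrum M.Next => M.nextX - 1 ∈ u.asIdeal) ht).mpr hmX
  · refine (congrArg (fun u : PrimeSpectrum M.Next => _ ≤ u.asIdeal.height) ht).mpr ?_
    refine le_trans ?_ hmh
    push_cast
    gcongr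
    exact M.le_height

end TowerModel

variable (a b c n) in
lemma nonempty_towerModel : Nonempty (TowerModel a b c n) := by
  induction n with
  | zero => exact nonempty_towerModel_zero
  | succ n ih => exact ih.some.nonempty_succ

end

/-! ### Integrality and dimension of `Xₙ` -/

section

variable {a b c : ℂ} {n : ℕ}

variable (a b c n) in
lemma isVariety_Xn : IsVariety (Xn a b c n) := by
  obtain ⟨M⟩ := nonempty_towerModel a b c n
  have : Nonempty (tower a b c n).left := ⟨M.pt⟩
  have : IsIntegral (tower a b c n).left := isIntegral_of_isOpenImmersion M.j
  exact ⟨this, inferInstanceAs (IsSeparated (towerStr a b c n)),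
    inferInstanceAs (LocallyOfFiniteType (towerStr a b c n)),
    inferInstanceAs (QuasiCompact (towerStr a b c n))⟩

lemma TowerModel.topologicalKrullDim_le (M : TowerModel a b c n) :
    topologicalKrullDim (tower a b c n).left ≤ n + 1 := by
  have h1 : topologicalKrullDim (tower a b c n).left ≤ topologicalKrullDim (Spec (.of M.D)) :=
    M.j.isOpenEmbedding.isInducing.topologicalKrullDim_le
  have h2 : topologicalKrullDim (Spec (.of M.D)) = ringKrullDim M.D :=
    PrimeSpectrum.topologicalKrullDim_eq_ringKrullDim M.D
  exact h1.trans (h2.trans_le M.dim_le)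

/-- The codimension of a point can be computed on an open neighbourhood, so the closed point of the
model bounds the dimension of `Xₙ` from below. -/
lemma TowerModel.le_topologicalKrullDim (M : TowerModel a b c n) :
    n + 1 ≤ topologicalKrullDim (tower a b c n).left := by
  have h1 : topologicalKrullDim (tower a b c n).left = Order.krullDim (tower a b c n).left :=
    Order.krullDim_eq_of_orderIso irreducibleSetEquivPoints
  have h2 := M.le_height
  rw [idealHeight_eq_coheight (.of M.D)] at h2
  have h3 : Order.coheight (M.j M.pt) = Order.coheight M.pt := coheight_eq_of_isOpenImmersion M.j
  rw [h3] at h2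
  rw [h1]
  refine le_trans ?_ (Order.coheight_le_krullDim M.pt)
  exact_mod_cast h2

variable (a b c n) in
lemma topologicalKrullDim_Xn : topologicalKrullDim (Xn a b c n).left = n + 1 := by
  obtain ⟨M⟩ := nonempty_towerModel a b c n
  exact le_antisymm M.topologicalKrullDim_le M.le_topologicalKrullDim

end

end NaiveA1

end

theorem theorem1p1 (a b c : ℂ) (ha : a ≠ 0) (hb : b ≠ 0) (hc : c ≠ 0)
    (hab : a ≠ b) (hac : a ≠ c) (hbc : b ≠ c) (n : ℕ) :
    NaiveA1.IsVariety (NaiveA1.Xn a b c n) ∧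
    topologicalKrullDim (NaiveA1.Xn a b c n).left = n + 1 ∧
    ¬ Function.Injective
      ((NaiveA1.naiveIterSucc (NaiveA1.points (NaiveA1.Xn a b c n)) n).app
        (Opposite.op (NaiveA1.pt ℂ))) :=
  ⟨NaiveA1.isVariety_Xn a b c n, NaiveA1.topologicalKrullDim_Xn a b c n,
    NaiveA1.not_injective_naiveIterSucc ha hb hc hab hac hbc n⟩
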